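/- Model. There are $n\ge 1$ nodes with pairwise distinct original identities in $\{1,\dots,N\}$, forming a fully connected synchronous network: each node has $n$ links, one to every node (itself included), and does not know in advance which link leads where. Initially a node knows only $n$ and its own identity. In each round a node draws private random bits, sends at most one message (a bit string) through each of its links, receives the messages sent to it in this round, and may then return a new identity and halt. An adaptive adversary, who knows the whole execution so far (including all random bits drawn up to that moment and the messages about to be sent), decides in each round which running nodes crash; of the messages that a crashing node was about to send in that round, only a subset chosen by the adversary is delivered, and afterwards the node does nothing. Any number of nodes (in particular, up to $n-1$) may crash. Let $f$ be the number of nodes that actually crash during the execution. Theorem. There are a constant $C$ and a randomized algorithm such that for all $n\ge1$ and $N$, all assignments of distinct identities in $\{1,\dots,N\}$ to the nodes, all arrangements of the links and all adaptive adversaries: (1) in every execution, within at most $C\log n$ rounds every node that has not crashed has returned a new identity in $\{1,\dots,n\}$, and the returned new identities are pairwise distinct (strong renaming); (2) with probability at least $1-1/n$, at most $C\,(f+\log n)\,n\log n$ messages are sent in the execution; (3) in every execution, at most $C\,n^2\log n$ messages are sent, and every message has at most $C\log N$ bits. -/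

import Mathlib

namespace Renaming

/-- The private random bits that one node draws at the beginning of one round. -/
abbrev Coins (b : ℕ) : Type := Fin b → Bool

/-- A randomized synchronous protocol for the complete network on `n` nodes, i.e. the code that
every node executes. A node has `n` links, numbered by `Fin n` (one of them leads to itself), and
a message is a string of bits. The code may depend on `n` and, through `init`, on the node's own
identity; it depends neither on the size of the original namespace nor on which links lead where. -/
structure Protocol (n : ℕ) where
  /-- local memory -/
  State : Type
  /-- number of fair private random bits that a node draws in each round -/
  coinBits : ℕ
  /-- memory upon activation, given the node's original identity -/
  init : ℕ → State
  /-- local computation at the beginning of a round, using fresh random bits -/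
  flip : State → Coins coinBits → State
  /-- the message (if any) sent through each link in the current round -/
  send : State → Fin n → Option (List Bool)
  /-- local computation at the end of a round, given the message (if any) received through
  each link -/
  recv : State → (Fin n → Option (List Bool)) → State
  /-- `some k`: the node returns the new identity `k` and halts; `none`: it goes on -/
  output : State → Option ℕ

/-- The status of a node: still running, halted with a new identity, or crashed. -/
inductive Status (S : Type) where
  | running (s : S) : Status S
  | returned (k : ℕ) : Status S
  | crashed : Status S

/-- What the adversary does to each node in one round: with `none` the node does not crash; with
`some S` it crashes in this round, and of the messages it was about to send only those on the links
in `S` go out (`S = ∅`: crash before sending; `S = univ`: crash after sending). -/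
abbrev CrashDecision (n : ℕ) : Type := Fin n → Option (Finset (Fin n))

variable {n : ℕ}

namespace Protocol

/-- The status of all nodes. -/
abbrev Config (P : Protocol n) : Type := Fin n → Status P.State

/-- A node halts as soon as its memory specifies an output. -/
def settle (P : Protocol n) (s : P.State) : Status P.State :=
  match P.output s with
  | some k => .returned k
  | none => .running s

/-- The configuration upon activation, where node `v` has the original identity `ident v`. -/
def start (P : Protocol n) (ident : Fin n → ℕ) : P.Config :=
  fun v => P.settle (P.init (ident v))

/-- All running nodes use their random bits of this round. -/
def flipAll (P : Protocol n) (coins : Fin n → Coins P.coinBits) (c : P.Config) : P.Config :=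
  fun v =>
    match c v with
    | .running s => .running (P.flip s (coins v))
    | x => x

/-- The message that `v` is about to send through its link `i`. -/
def outgoing (P : Protocol n) (c : P.Config) (v i : Fin n) : Option (List Bool) :=
  match c v with
  | .running s => P.send s i
  | _ => none

/-- The message of `v` on its link `i` that actually goes out, given the crashes. -/
def transmitted (P : Protocol n) (c : P.Config) (d : CrashDecision n) (v i : Fin n) :
    Option (List Bool) :=
  match d v with
  | none => P.outgoing c v i
  | some S => if i ∈ S then P.outgoing c v i else none

/-- The message that `v` receives through its link `i`. Link `i` of `v` leads to `port v i`. -/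
def inbox (P : Protocol n) (port : Fin n → Equiv.Perm (Fin n)) (c : P.Config)
    (d : CrashDecision n) (v i : Fin n) : Option (List Bool) :=
  P.transmitted c d (port v i) ((port (port v i)).symm v)

/-- The second half of a round: crashes, delivery of the messages, and the computations of the
nodes that are still running. Nodes that have halted are not affected by crashes. -/
def deliver (P : Protocol n) (port : Fin n → Equiv.Perm (Fin n)) (c : P.Config)
    (d : CrashDecision n) : P.Config :=
  fun v =>
    match c v with
    | .running s =>
      match d v with
      | none => P.settle (P.recv s (P.inbox port c d v))
      | some _ => .crashed
    | x => x

/-- The number of messages of a round that starts sending in configuration `c`. All messages that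
running nodes are about to send are counted, even those that do not go out because of a crash. -/
def messagesFrom (P : Protocol n) (c : P.Config) : ℕ :=
  (Finset.univ.filter fun x : Fin n × Fin n => (P.outgoing c x.1 x.2).isSome).card

/-- The record of one round: random bits of the nodes, configuration just before messages are sent,
and crashes. -/
structure RoundRecord (P : Protocol n) where
  coins : Fin n → Coins P.coinBits
  config : P.Config
  crashes : CrashDecision n

/-- An adaptive adversary: in every round, it decides which nodes crash (and which of their
messages still go out) knowing the complete history of all previous rounds, the random bits that
were drawn in the current round, and the current memory of all nodes, hence also all messages that
are about to be sent. -/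
abbrev Adversary (P : Protocol n) : Type :=
  List P.RoundRecord → (Fin n → Coins P.coinBits) → P.Config → CrashDecision n

/-- An execution over a number of rounds: the records of these rounds in chronological order, and
the resulting configuration. -/
structure Execution (P : Protocol n) where
  history : List P.RoundRecord
  config : P.Config

/-- One more round. -/
def step (P : Protocol n) (port : Fin n → Equiv.Perm (Fin n)) (adv : P.Adversary)
    (coins : Fin n → Coins P.coinBits) (E : P.Execution) : P.Execution :=
  let c := P.flipAll coins E.config
  let d := adv E.history coins c
  { history := E.history ++ [⟨coins, c, d⟩]
    config := P.deliver port c d }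

/-- The execution of the first `T` rounds, where `ω t v` are the random bits of node `v` in the
`t`-th round. -/
def run (P : Protocol n) (ident : Fin n → ℕ) (port : Fin n → Equiv.Perm (Fin n))
    (adv : P.Adversary) : (T : ℕ) → (Fin T → Fin n → Coins P.coinBits) → P.Execution
  | 0, _ => { history := [], config := P.start ident }
  | T + 1, ω => P.step port adv (ω (Fin.last T)) (P.run ident port adv T (Fin.init ω))

namespace Execution

variable {P : Protocol n}

/-- Every node has returned or crashed. -/
def Terminated (E : P.Execution) : Prop :=
  ∀ v s, E.config v ≠ .running s

/-- All returned new identities lie in `{1, …, n}`, and no two nodes returned the same one. -/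
def StrongRenaming (E : P.Execution) : Prop :=
  (∀ v k, E.config v = .returned k → k ∈ Set.Icc 1 n) ∧
    ∀ u v k, E.config u = .returned k → E.config v = .returned k → u = v

/-- The number of messages sent. -/
def messages (E : P.Execution) : ℕ :=
  (E.history.map fun r => P.messagesFrom r.config).sum

/-- The number of nodes that crashed. -/
noncomputable def crashes (E : P.Execution) : ℕ :=
  Set.ncard {v | E.config v = .crashed}

/-- Every message sent has at most `B` bits. -/
def MessageBitsLE (E : P.Execution) (B : ℝ) : Prop :=
  ∀ r ∈ E.history, ∀ v i m, P.outgoing r.config v i = some m → (m.length : ℝ) ≤ B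

end Execution

end Protocol

end Renaming

/-! The nodes walk down a binary tree with `2 ^ L` leaves, `L = Nat.clog 2 n`, and a node that
reaches leaf `2 ^ L + k` takes the name `k + 1`. The moves are dictated by a small random committee
that is elected anew in each phase. Give a subtree the capacity of the number of its leaves with `k
< n`. If no subtree ever holds more running nodes than its capacity, the final leaves are distinct
and among the first `n`. Answers preserve this invariant (`load_move`, `Scenario.load_le_capacity`)
even if members have seen different sets of reports, since each such set lies between the nodes
alive before and after the phase.

A node that hears no answer raises its level, which doubles its election probability, starting from
`2 ^ (-L)`. At level `L` it elects itself with certainty and answers itself, so levels stay at most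
`L`. Each phase moves a node down or raises its level unless it is at a leaf; hence `2 * L` phases
suffice (`Scenario.progress`).

For the messages, a phase costs at most `3 * n` times the size of its committee. The mean committee
size is at most 1 at first and grows only in a failing phase, one that leaves a surviving node
unanswered, where it at most doubles. In such a phase the whole committee has crashed, so the
failing committees have at most `f` members in total. It remains to compare committee sizes with
their conditional means against an adaptive adversary. The `potential` of a round has conditional
mean at most 3 whatever the past, because the coins of the round are fresh; so the product over `T`
rounds has mean at most `3 ^ T` (`sum_totalPotential_le`), and Markov's inequality bounds it by `n *
3 ^ T` with probability at least `1 - 1 / n`. Its logarithm, `O(log n)`, controls all deviations at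
once (`Scenario.sum_committee_le`). -/

namespace Renaming

section Committee

open scoped Classical
open Finset

/-! ### The binary tree

The nodes of the tree are numbered as in a binary heap: the root is `1` and the children of `h` are
`2 * h` and `2 * h + 1`. -/

/-- `x` lies in the subtree rooted at `h`. -/
def Below (x h : ℕ) : Prop := ∃ j, x / 2 ^ j = h

theorem Below.refl (x : ℕ) : Below x x := ⟨0, by simp⟩

theorem Below.le {x h : ℕ} (hx : Below x h) : h ≤ x := by
  obtain ⟨j, rfl⟩ := hx
  exact Nat.div_le_self _ _

theorem Below.trans {x y z : ℕ} (h₁ : Below x y) (h₂ : Below y z) : Below x z := by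
  obtain ⟨i, rfl⟩ := h₁
  obtain ⟨j, rfl⟩ := h₂
  exact ⟨i + j, by rw [pow_add, Nat.div_div_eq_div_mul]⟩

theorem below_left (h : ℕ) : Below (2 * h) h := ⟨1, by omega⟩

theorem below_right (h : ℕ) : Below (2 * h + 1) h := ⟨1, by omega⟩

theorem below_iff {x h : ℕ} :
    Below x h ↔ x = h ∨ Below x (2 * h) ∨ Below x (2 * h + 1) := by
  constructor
  · rintro ⟨_ | j, hj⟩
    · left; simpa using hj
    · right
      rw [pow_succ, ← Nat.div_div_eq_div_mul] at hj
      rcases (by omega : x / 2 ^ j = 2 * h ∨ x / 2 ^ j = 2 * h + 1) with h' | h'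
      · exact Or.inl ⟨j, h'⟩
      · exact Or.inr ⟨j, h'⟩
  · rintro (rfl | h' | h')
    · exact Below.refl _
    · exact h'.trans (below_left h)
    · exact h'.trans (below_right h)

theorem Below.total {x y z : ℕ} (hy : Below x y) (hz : Below x z) : Below y z ∨ Below z y := by
  obtain ⟨i, rfl⟩ := hy
  obtain ⟨j, rfl⟩ := hz
  rcases le_total i j with h | h
  · obtain ⟨k, rfl⟩ := Nat.exists_eq_add_of_le h
    exact Or.inl ⟨k, by rw [pow_add, Nat.div_div_eq_div_mul]⟩
  · obtain ⟨k, rfl⟩ := Nat.exists_eq_add_of_le h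
    exact Or.inr ⟨k, by rw [pow_add, Nat.div_div_eq_div_mul]⟩

theorem not_below_left_right {x h : ℕ} (hh : 1 ≤ h) :
    ¬(Below x (2 * h) ∧ Below x (2 * h + 1)) := by
  rintro ⟨h₁, h₂⟩
  rcases h₁.total h₂ with h' | ⟨j, hj⟩
  · have := h'.le
    omega
  · rcases j with _ | j
    · simp at hj
    · rw [pow_succ', ← Nat.div_div_eq_div_mul] at hj
      have := Nat.div_le_self ((2 * h + 1) / 2) (2 ^ j)
      omega

theorem below_one {x : ℕ} (hx : 1 ≤ x) : Below x 1 :=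
  ⟨Nat.log 2 x, Nat.div_eq_of_lt_le (by simpa using Nat.pow_log_le_self 2 (by omega))
    (by simpa [pow_succ'] using Nat.lt_pow_succ_log_self one_lt_two x)⟩

/-! ### Loads of subtrees and their change under moves. -/

variable {α : Type*}

/-- The number of elements of `S` with position in the subtree rooted at `h`. -/
noncomputable def load (S : Finset α) (pos : α → ℕ) (h : ℕ) : ℕ :=
  #{v ∈ S | Below (pos v) h}

/-- The number of elements of `S` with position `h` and key at most `a`. -/
noncomputable def rank (S : Finset α) (pos key : α → ℕ) (h a : ℕ) : ℕ :=
  #{v ∈ S | pos v = h ∧ key v ≤ a}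

theorem load_mono {S S' : Finset α} (hS : S ⊆ S') (pos : α → ℕ) (h : ℕ) :
    load S pos h ≤ load S' pos h :=
  card_le_card (filter_subset_filter _ hS)

theorem load_eq_add (S : Finset α) (pos : α → ℕ) {h : ℕ} (hh : 1 ≤ h) :
    load S pos h = #{v ∈ S | pos v = h} + load S pos (2 * h) + load S pos (2 * h + 1) := by
  unfold load
  rw [← card_union_of_disjoint, ← card_union_of_disjoint, ← filter_or, ← filter_or]
  · congr 1
    ext v
    simp only [mem_filter, below_iff (x := pos v) (h := h), or_assoc]
  · rw [← filter_or, disjoint_filter]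
    rintro v - (hv | hv) hv'
    · have := hv'.le
      omega
    · exact not_below_left_right hh ⟨hv, hv'⟩
  · rw [disjoint_filter]
    rintro v - hv hv'
    have := hv'.le
    omega

/-- If the subtrees are not overloaded and some elements move to a child of their position,
each based on the positions of a set of elements between the present and the remaining ones,
then the subtrees are not overloaded by the remaining elements. -/
theorem load_move {S₀ S₁ : Finset α} {pos pos' key : α → ℕ} {cap : ℕ → ℕ}
    (hkey : Function.Injective key) (hS : S₁ ⊆ S₀) (hpos : ∀ v, 1 ≤ pos v)
    (hload : ∀ h, 1 ≤ h → load S₀ pos h ≤ cap h)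
    (hmove : ∀ v ∈ S₁, pos' v = pos v ∨
      cap (pos v) = cap (2 * pos v) + cap (2 * pos v + 1) ∧ ∃ V, S₁ ⊆ V ∧ V ⊆ S₀ ∧
        (pos' v = 2 * pos v ∧
            load V pos (2 * pos v) + rank V pos key (pos v) (key v) ≤ cap (2 * pos v) ∨
          pos' v = 2 * pos v + 1 ∧
            cap (2 * pos v) < load V pos (2 * pos v) + rank V pos key (pos v) (key v)))
    {h : ℕ} (hh : 1 ≤ h) : load S₁ pos' h ≤ cap h := by
  set A : Finset α := {v ∈ S₁ | pos' v = h ∧ pos' v ≠ pos v} with hA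
  -- A move follows a single edge downwards, so the subtree of `h` can only be entered from outside
  -- by landing on `h` itself.
  have hsub : ∀ V, S₁ ⊆ V → load S₁ pos' h ≤ load V pos h + #A := by
    intro V hV
    unfold load
    refine (card_le_card ?_).trans (card_union_le _ _)
    intro v hv
    simp only [mem_filter, mem_union, hA] at hv ⊢
    by_cases hmv : pos' v = pos v
    · exact Or.inl ⟨hV hv.1, hmv ▸ hv.2⟩
    · by_cases hph : pos' v = h
      · exact Or.inr ⟨hv.1, hph, hmv⟩
      · left
        refine ⟨hV hv.1, ?_⟩
        have hb : Below (pos' v) (pos v) := by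
          rcases hmove v hv.1 with h' | ⟨-, V, -, -, ⟨h', -⟩ | ⟨h', -⟩⟩
          · exact h' ▸ Below.refl _
          · exact h' ▸ below_left _
          · exact h' ▸ below_right _
        obtain ⟨j, hj⟩ := hv.2
        rcases j with _ | j
        · exact absurd (by simpa using hj) hph
        · rcases hmove v hv.1 with h' | ⟨-, V, -, -, ⟨h', -⟩ | ⟨h', -⟩⟩
          · exact absurd h' hmv
          all_goals
            refine ⟨j, ?_⟩
            rw [← hj, h', pow_succ', ← Nat.div_div_eq_div_mul]
            congr 1
            omega
  rcases A.eq_empty_or_nonempty with hAe | hAne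
  · have := hsub S₀ hS
    rw [hAe] at this
    simpa using this.trans (by simpa using hload h hh)
  have hAmem : ∀ v ∈ A, v ∈ S₁ ∧ pos' v = h ∧ pos' v ≠ pos v := fun v hv => by simpa [hA] using hv
  have hparent : ∀ v ∈ A, pos v = h / 2 := by
    intro v hv
    obtain ⟨hv₁, hv₂, hv₃⟩ := hAmem v hv
    rcases hmove v hv₁ with h' | ⟨-, V, -, -, ⟨h', -⟩ | ⟨h', -⟩⟩
    · exact absurd h' hv₃
    all_goals omega
  obtain ⟨g, hg⟩ : ∃ g, g = h / 2 := ⟨_, rfl⟩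
  rw [← hg] at hparent
  rcases Nat.even_or_odd' h with ⟨m, rfl | rfl⟩
  -- Left child: the arrival with the largest key counted all the other arrivals in its rank, so its
  -- own test bounds the new load.
  · obtain ⟨v, hvA, hv⟩ := A.exists_max_image key hAne
    obtain ⟨hv₁, hv₂, hv₃⟩ := hAmem v hvA
    obtain rfl : g = m := by omega
    have hp := hparent v hvA
    rcases hmove v hv₁ with h' | ⟨-, V, hV₁, hV₂, ⟨-, h'⟩ | ⟨h', -⟩⟩
    · exact absurd h' hv₃
    · refine (hsub V hV₁).trans (le_trans ?_ (hp ▸ h'))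
      refine Nat.add_le_add_left (card_le_card fun u hu => ?_) _
      simp only [mem_filter]
      exact ⟨hV₁ (hAmem u hu).1, hparent u hu, hv u hu⟩
    · omega
  -- Right child: for the arrival with the smallest key, the left subtree and the smaller keys at
  -- the parent already fill the left capacity. What remains of the parent's load, including all
  -- arrivals, fits on the right.
  · obtain ⟨v, hvA, hv⟩ := A.exists_min_image key hAne
    obtain ⟨hv₁, hv₂, hv₃⟩ := hAmem v hvA
    obtain rfl : g = m := by omega
    have hp := hparent v hvA
    rcases hmove v hv₁ with h' | ⟨hcap, V, hV₁, hV₂, ⟨h', -⟩ | ⟨-, h'⟩⟩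
    · exact absurd h' hv₃
    · omega
    · rw [hp] at h' hcap
      have hg1 : 1 ≤ g := hp ▸ hpos v
      have h₁ := hsub V hV₁
      have h₂ := load_eq_add V pos hg1
      have h₃ := (load_mono hV₂ pos g).trans (hload g hg1)
      have h₄ : rank V pos key g (key v) ≤ #{u ∈ V | pos u = g ∧ key u < key v} + 1 := by
        rw [← card_singleton v]
        refine (card_le_card fun u hu => ?_).trans (card_union_le _ _)
        simp only [mem_filter, mem_union, mem_singleton] at hu ⊢
        rcases hu.2.2.lt_or_eq with hlt | heq
        · exact Or.inl ⟨hu.1, hu.2.1, hlt⟩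
        · exact Or.inr (hkey heq)
      have h₅ : #{u ∈ V | pos u = g ∧ key u < key v} + #A ≤ #{u ∈ V | pos u = g} := by
        rw [← card_union_of_disjoint]
        · refine card_le_card fun u hu => ?_
          simp only [mem_filter, mem_union] at hu ⊢
          rcases hu with hu | hu
          · exact ⟨hu.1, hu.2.1⟩
          · exact ⟨hV₁ (hAmem u hu).1, hparent u hu⟩
        · rw [disjoint_left]
          intro u hu hu'
          simp only [mem_filter] at hu
          exact absurd (hv u hu') (not_le.2 hu.2.2)
      omega

/-! ### Capacities of subtrees. -/

/-- The number of leaves `2 ^ L + k` with `k < n` in the subtree rooted at `h`, where `2 ^ L` is the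
least power of two that is at least `n`. -/
noncomputable def capacity (n h : ℕ) : ℕ := load (range n) (fun k => 2 ^ Nat.clog 2 n + k) h

theorem capacity_eq_add {n h : ℕ} (hh : 1 ≤ h) (hL : h < 2 ^ Nat.clog 2 n) :
    capacity n h = capacity n (2 * h) + capacity n (2 * h + 1) := by
  unfold capacity
  rw [load_eq_add _ _ hh, filter_false_of_mem, card_empty, zero_add]
  intro k _
  omega

theorem capacity_one (n : ℕ) : capacity n 1 = n := by
  unfold capacity load
  rw [filter_true_of_mem, card_range]
  exact fun k _ => below_one (Nat.le_add_right_of_le Nat.one_le_two_pow)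

/-- A proper descendant of `h` is at least `2 * h ≥ 2 ^ (L + 1)`, where `L = Nat.clog 2 n`, while `k
< n ≤ 2 ^ L`. -/
theorem below_leaf {n k h : ℕ} (hk : k < n) (hh : 2 ^ Nat.clog 2 n ≤ h)
    (hb : Below (2 ^ Nat.clog 2 n + k) h) : 2 ^ Nat.clog 2 n + k = h := by
  obtain ⟨_ | j, hj⟩ := hb
  · simpa using hj
  · rw [pow_succ', ← Nat.div_div_eq_div_mul] at hj
    have := Nat.div_le_self ((2 ^ Nat.clog 2 n + k) / 2) (2 ^ j)
    have := Nat.le_pow_clog one_lt_two n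
    omega

theorem capacity_leaf_le {n h : ℕ} (hh : 2 ^ Nat.clog 2 n ≤ h) : capacity n h ≤ 1 := by
  unfold capacity load
  refine card_le_one.2 fun a ha b hb => ?_
  simp only [mem_filter, mem_range] at ha hb
  have := below_leaf ha.1 hh ha.2
  have := below_leaf hb.1 hh hb.2
  omega

theorem lt_of_capacity_pos {n h : ℕ} (hh : 2 ^ Nat.clog 2 n ≤ h) (hc : 1 ≤ capacity n h) :
    h - 2 ^ Nat.clog 2 n < n := by
  unfold capacity load at hc
  obtain ⟨k, hk⟩ := card_pos.1 hc
  simp only [mem_filter, mem_range] at hk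
  have := below_leaf hk.1 hh hk.2
  omega

/-! ### The protocol -/

/-- The number with the given binary digits, least significant digit first. -/
def ofBits (l : List Bool) : ℕ := l.foldr Nat.bit 0

theorem ofBits_bits (a : ℕ) : ofBits a.bits = a := by
  induction a using Nat.binaryRec' with
  | zero => simp [ofBits]
  | bit b a h ih =>
    rw [Nat.bits_append_bit a b h]
    simpa [ofBits] using congrArg (Nat.bit b) ih

/-- The encoding of an identity and a position by a message. -/
def encode (a : ℕ × ℕ) : List Bool := (Nat.pair a.1 a.2).bits

/-- The inverse of `encode`. -/
def decode (m : List Bool) : ℕ × ℕ := Nat.unpair (ofBits m)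

theorem decode_encode (a : ℕ × ℕ) : decode (encode a) = a := by
  simp [decode, encode, ofBits_bits]

variable {n : ℕ}

/-- The memory of a node. -/
structure Memory (n : ℕ) where
  /-- the number of rounds so far -/
  time : ℕ
  /-- the original identity -/
  ident : ℕ
  /-- the position in the tree -/
  pos : ℕ
  /-- the number of phases without an answer -/
  level : ℕ
  /-- whether the node is a member of the committee of the current phase -/
  elected : Bool
  /-- the messages received in the previous round -/
  inbox : Fin n → Option (List Bool)

/-- The answer of a committee member which received the reports `view` to the one of them with
content `m`: whether to move to the right child. A node moves to the left child if there is room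
for all nodes in the left subtree and all nodes at the same position with at most the same
identity. -/
noncomputable def direction (view : Fin n → Option (List Bool)) (m : List Bool) : Bool :=
  decide (capacity n (2 * (decode m).2) <
    #{i | ∃ r, view i = some r ∧ Below (decode r).2 (2 * (decode m).2)} +
    #{i | ∃ r, view i = some r ∧ (decode r).2 = (decode m).2 ∧ (decode r).1 ≤ (decode m).1})

/-- A node with level `j` is elected by the coins `x` if the first `clog 2 n - j` of them show
`true`. -/
def Elects (n j : ℕ) (x : Coins (Nat.clog 2 n)) : Prop :=
  ∀ i : Fin (Nat.clog 2 n), i.val < Nat.clog 2 n - j → x i = true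

/-- The position after receiving the answers `m`. -/
noncomputable def Memory.newPos (s : Memory n) (m : Fin n → Option (List Bool)) : ℕ :=
  if s.time % 3 = 2 ∧ s.pos < 2 ^ Nat.clog 2 n then
    -- Members may give conflicting answers. Either one is admissible in `load_move`, so the
    -- preference for the right child is arbitrary.
    if ∃ i, m i = some [true] then 2 * s.pos + 1
    else if ∃ i, m i = some [false] then 2 * s.pos
    else s.pos
  else s.pos

/-- The level after receiving the answers `m`. -/
noncomputable def Memory.newLevel (s : Memory n) (m : Fin n → Option (List Bool)) : ℕ :=
  if s.time % 3 = 2 ∧ ∀ i, m i = none then s.level + 1 else s.level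

/-- The protocol consists of `2 * clog 2 n` phases of three rounds. In the first round of a phase,
each node decides at random, with a probability that depends on its level, whether it is a member of
the committee, and the members announce this to all nodes. In the second round, all nodes report
their identity and their position to the members. In the third round the members answer to the
reports. -/
noncomputable def protocol (n : ℕ) : Protocol n where
  State := Memory n
  coinBits := Nat.clog 2 n
  init x := ⟨0, x, 1, 0, false, fun _ => none⟩
  flip s x := if s.time % 3 = 0 then { s with elected := decide (Elects n s.level x) } else s
  send s i :=
    if s.time % 3 = 0 then if s.elected then some [] else none
    else if s.time % 3 = 1 then (s.inbox i).map fun _ => encode (s.ident, s.pos)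
    else if s.elected then (s.inbox i).map fun m => [direction s.inbox m] else none
  recv s m := ⟨s.time + 1, s.ident, s.newPos m, s.newLevel m, s.elected, m⟩
  output s :=
    -- For `n = 1` this is time 0: the node halts at the root, which is then the only leaf, with
    -- name 1.
    if 6 * Nat.clog 2 n ≤ s.time then some (s.pos - 2 ^ Nat.clog 2 n + 1) else none

/-! ### Trajectories -/

/-- Everything that determines an execution of the protocol. -/
structure Scenario (n : ℕ) where
  /-- the original identities -/
  ident : Fin n → ℕ
  /-- the links -/
  port : Fin n → Equiv.Perm (Fin n)
  /-- the random bits -/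
  coins : ℕ → Fin n → Coins (Nat.clog 2 n)
  /-- the crashes -/
  crash : ℕ → CrashDecision n

namespace Scenario

variable (e : Scenario n)

/-- The messages that are delivered, given the nodes that have not crashed before and the
memory of the nodes before sending. -/
noncomputable def mail (d : CrashDecision n) (R : Finset (Fin n)) (M : Fin n → Memory n)
    (v i : Fin n) : Option (List Bool) :=
  if e.port v i ∈ R ∧ ∀ S, d (e.port v i) = some S → (e.port (e.port v i)).symm v ∈ S then
    (protocol n).send (M (e.port v i)) ((e.port (e.port v i)).symm v)
  else none

/-- The nodes that have not crashed in the first `t` rounds, and the memory of the nodes. -/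
noncomputable def state : ℕ → Finset (Fin n) × (Fin n → Memory n)
  | 0 => (univ, fun v => (protocol n).init (e.ident v))
  | t + 1 =>
    -- Memories evolve for all nodes, crashed or not, and without end; `mail` suppresses messages of
    -- crashed nodes and `config` restores the true statuses.
    let M := fun v => (protocol n).flip ((state t).2 v) (e.coins t v)
    ({v ∈ (state t).1 | e.crash t v = none},
      fun v => (protocol n).recv (M v) (e.mail (e.crash t) (state t).1 M v))

/-- The nodes that have not crashed in the first `t` rounds. -/
noncomputable def alive (t : ℕ) : Finset (Fin n) := (e.state t).1

/-- The memory of the nodes after `t` rounds. -/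
noncomputable def mem (t : ℕ) : Fin n → Memory n := (e.state t).2

/-- The memory of the nodes before sending in the round after `t` rounds. -/
noncomputable def active (t : ℕ) (v : Fin n) : Memory n :=
  (protocol n).flip (e.mem t v) (e.coins t v)

/-- The messages received in the round after `t` rounds. -/
noncomputable def received (t : ℕ) : Fin n → Fin n → Option (List Bool) :=
  e.mail (e.crash t) (e.alive t) (e.active t)

theorem alive_zero : e.alive 0 = univ := rfl

theorem mem_zero (v : Fin n) : e.mem 0 v = ⟨0, e.ident v, 1, 0, false, fun _ => none⟩ := rfl

theorem alive_succ (t : ℕ) : e.alive (t + 1) = {v ∈ e.alive t | e.crash t v = none} := rfl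

theorem mem_succ (t : ℕ) (v : Fin n) :
    e.mem (t + 1) v = (protocol n).recv (e.active t v) (e.received t v) := rfl

theorem alive_succ_subset (t : ℕ) : e.alive (t + 1) ⊆ e.alive t := filter_subset _ _

theorem alive_antitone : Antitone e.alive := antitone_nat_of_succ_le e.alive_succ_subset

theorem crash_eq_none {t : ℕ} {v : Fin n} (hv : v ∈ e.alive (t + 1)) : e.crash t v = none := by
  rw [alive_succ, mem_filter] at hv
  exact hv.2

theorem received_of_mem {t : ℕ} {u : Fin n} (hu : u ∈ e.alive (t + 1)) (v : Fin n) :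
    e.received t v ((e.port v).symm u) = (protocol n).send (e.active t u) ((e.port u).symm v) := by
  have h₁ := e.alive_succ_subset t hu
  have h₂ := e.crash_eq_none hu
  simp [received, mail, h₁, h₂]

theorem of_received {t : ℕ} {v i : Fin n} {m : List Bool} (hm : e.received t v i = some m) :
    e.port v i ∈ e.alive t ∧
      (protocol n).send (e.active t (e.port v i)) ((e.port (e.port v i)).symm v) = some m := by
  unfold received mail at hm
  split_ifs at hm with h
  exact ⟨h.1, hm⟩

theorem active_eq (t : ℕ) (v : Fin n) : e.active t v =
    if (e.mem t v).time % 3 = 0 then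
      { e.mem t v with elected := decide (Elects n (e.mem t v).level (e.coins t v)) }
    else e.mem t v := rfl

theorem active_time (t : ℕ) (v : Fin n) : (e.active t v).time = (e.mem t v).time := by
  rw [active_eq]; split_ifs <;> rfl

theorem active_ident (t : ℕ) (v : Fin n) : (e.active t v).ident = (e.mem t v).ident := by
  rw [active_eq]; split_ifs <;> rfl

theorem active_pos (t : ℕ) (v : Fin n) : (e.active t v).pos = (e.mem t v).pos := by
  rw [active_eq]; split_ifs <;> rfl

theorem active_level (t : ℕ) (v : Fin n) : (e.active t v).level = (e.mem t v).level := by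
  rw [active_eq]; split_ifs <;> rfl

theorem active_inbox (t : ℕ) (v : Fin n) : (e.active t v).inbox = (e.mem t v).inbox := by
  rw [active_eq]; split_ifs <;> rfl

theorem mem_time (t : ℕ) (v : Fin n) : (e.mem t v).time = t := by
  induction t with
  | zero => rfl
  | succ t ih => rw [mem_succ]; simp [protocol, active_time, ih]

theorem mem_ident (t : ℕ) (v : Fin n) : (e.mem t v).ident = e.ident v := by
  induction t with
  | zero => rfl
  | succ t ih => rw [mem_succ]; simp [protocol, active_ident, ih]

theorem mem_succ_inbox (t : ℕ) (v : Fin n) : (e.mem (t + 1) v).inbox = e.received t v := rfl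

theorem mem_succ_elected (t : ℕ) (v : Fin n) :
    (e.mem (t + 1) v).elected = (e.active t v).elected := rfl

theorem mem_succ_pos (t : ℕ) (v : Fin n) : (e.mem (t + 1) v).pos =
    if t % 3 = 2 ∧ (e.mem t v).pos < 2 ^ Nat.clog 2 n then
      if ∃ i, e.received t v i = some [true] then 2 * (e.mem t v).pos + 1
      else if ∃ i, e.received t v i = some [false] then 2 * (e.mem t v).pos
      else (e.mem t v).pos
    else (e.mem t v).pos := by
  rw [mem_succ]
  simp [protocol, Memory.newPos, active_time, active_pos, mem_time]

theorem mem_succ_level (t : ℕ) (v : Fin n) : (e.mem (t + 1) v).level =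
    if t % 3 = 2 ∧ ∀ i, e.received t v i = none then (e.mem t v).level + 1
    else (e.mem t v).level := by
  rw [mem_succ]
  simp [protocol, Memory.newLevel, active_time, active_level, mem_time]

theorem active_elected_of_mod_eq_zero {t : ℕ} (ht : t % 3 = 0) (v : Fin n) :
    (e.active t v).elected = decide (Elects n (e.mem t v).level (e.coins t v)) := by
  rw [active_eq, mem_time, if_pos ht]

theorem active_of_mod_ne_zero {t : ℕ} (ht : t % 3 ≠ 0) (v : Fin n) : e.active t v = e.mem t v := by
  rw [active_eq, mem_time, if_neg ht]

theorem send_active (t : ℕ) (v i : Fin n) : (protocol n).send (e.active t v) i =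
    if t % 3 = 0 then if (e.active t v).elected then some [] else none
    else if t % 3 = 1 then
      ((e.mem t v).inbox i).map fun _ => encode (e.ident v, (e.mem t v).pos)
    else if (e.active t v).elected then
      ((e.mem t v).inbox i).map fun m => [direction (e.mem t v).inbox m] else none := by
  simp only [protocol, active_time, mem_time, active_inbox, active_ident, mem_ident, active_pos]

/-- The status of a node in terms of the trajectory. -/
noncomputable def config (t : ℕ) : (protocol n).Config := fun v =>
  if v ∈ e.alive t then (protocol n).settle (e.mem t v) else .crashed

theorem settle_mem (t : ℕ) (v : Fin n) : (protocol n).settle (e.mem t v) =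
    if 6 * Nat.clog 2 n ≤ t then .returned ((e.mem t v).pos - 2 ^ Nat.clog 2 n + 1)
    else .running (e.mem t v) := by
  have h : (protocol n).output (e.mem t v) = if 6 * Nat.clog 2 n ≤ t then
      some ((e.mem t v).pos - 2 ^ Nat.clog 2 n + 1) else none := by
    simp only [protocol, mem_time]
  unfold Protocol.settle
  rw [h]
  by_cases h' : 6 * Nat.clog 2 n ≤ t <;> simp only [h', if_true, if_false]

theorem config_zero : e.config 0 = (protocol n).start e.ident := by
  funext v
  simp [config, alive_zero, Protocol.start, mem]
  rfl

theorem flipAll_config {t : ℕ} (ht : t < 6 * Nat.clog 2 n) :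
    (protocol n).flipAll (e.coins t) (e.config t) =
      fun v => if v ∈ e.alive t then .running (e.active t v) else .crashed := by
  funext v
  by_cases hv : v ∈ e.alive t
  · simp only [Protocol.flipAll, config, hv, if_true, settle_mem, not_le.2 ht, if_false]
    rfl
  · simp only [Protocol.flipAll, config, hv, if_false]

theorem config_succ {t : ℕ} (ht : t < 6 * Nat.clog 2 n) :
    e.config (t + 1) = (protocol n).deliver e.port
      ((protocol n).flipAll (e.coins t) (e.config t)) (e.crash t) := by
  rw [e.flipAll_config ht]
  funext v
  by_cases hv : v ∈ e.alive t
  · rcases hd : e.crash t v with _ | S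
    · have hv' : v ∈ e.alive (t + 1) := by rw [alive_succ, mem_filter]; exact ⟨hv, hd⟩
      simp only [config, hv', if_true, Protocol.deliver, hv, hd, mem_succ]
      congr 2
      funext i
      simp only [received, mail, Protocol.inbox, Protocol.transmitted, Protocol.outgoing]
      by_cases hu : e.port v i ∈ e.alive t
      · rcases hd' : e.crash t (e.port v i) with _ | S <;> simp [hu]
      · rcases hd' : e.crash t (e.port v i) with _ | S <;> simp [hu]
    · have hv' : v ∉ e.alive (t + 1) := by rw [alive_succ, mem_filter]; simp [hd]
      simp [config, hv', Protocol.deliver, hv, hd]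
  · have hv' : v ∉ e.alive (t + 1) := fun h => hv (e.alive_succ_subset t h)
    simp [config, hv', Protocol.deliver, hv]

end Scenario

namespace Scenario

variable (e : Scenario n)

/-! ### One phase -/

/-- The members of the committee of phase `k`. -/
noncomputable def committee (k : ℕ) : Finset (Fin n) :=
  {u ∈ e.alive (3 * k) | (e.active (3 * k) u).elected}

theorem active_elected_one (k : ℕ) (u : Fin n) :
    (e.active (3 * k + 1) u).elected = (e.active (3 * k) u).elected := by
  rw [e.active_of_mod_ne_zero (by omega), mem_succ_elected]

theorem active_elected_two (k : ℕ) (u : Fin n) :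
    (e.active (3 * k + 2) u).elected = (e.active (3 * k) u).elected := by
  rw [e.active_of_mod_ne_zero (by omega), mem_succ_elected, active_elected_one]

theorem mem_pos_one (k : ℕ) (v : Fin n) : (e.mem (3 * k + 1) v).pos = (e.mem (3 * k) v).pos := by
  rw [mem_succ_pos, if_neg (by omega)]

theorem mem_pos_two (k : ℕ) (v : Fin n) : (e.mem (3 * k + 2) v).pos = (e.mem (3 * k) v).pos := by
  rw [mem_succ_pos, if_neg (by omega), mem_pos_one]

theorem mem_level_two (k : ℕ) (v : Fin n) :
    (e.mem (3 * k + 2) v).level = (e.mem (3 * k) v).level := by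
  rw [mem_succ_level, if_neg (by omega), mem_succ_level, if_neg (by omega)]

theorem mem_committee_of_inbox {k : ℕ} {v i : Fin n} {m : List Bool}
    (h : (e.mem (3 * k + 1) v).inbox i = some m) : e.port v i ∈ e.committee k := by
  rw [mem_succ_inbox] at h
  obtain ⟨h₁, h₂⟩ := e.of_received h
  rw [send_active, if_pos (by omega)] at h₂
  rw [committee, mem_filter]
  refine ⟨h₁, ?_⟩
  by_contra hne
  rw [if_neg hne] at h₂
  cases h₂

theorem inbox_of_elected {k : ℕ} {u : Fin n} (hu : u ∈ e.alive (3 * k + 1))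
    (hel : (e.active (3 * k) u).elected = true) (v : Fin n) :
    (e.mem (3 * k + 1) v).inbox ((e.port v).symm u) = some [] := by
  rw [mem_succ_inbox, e.received_of_mem hu, send_active, if_pos (by omega), if_pos hel]

theorem report_of_inbox {k : ℕ} {u i : Fin n} {m : List Bool}
    (h : (e.mem (3 * k + 2) u).inbox i = some m) : e.port u i ∈ e.alive (3 * k + 1) ∧
      m = encode (e.ident (e.port u i), (e.mem (3 * k) (e.port u i)).pos) := by
  rw [mem_succ_inbox] at h
  obtain ⟨h₁, h₂⟩ := e.of_received h
  rw [send_active, if_neg (by omega), if_pos (by omega), mem_pos_one, Option.map_eq_some_iff] at h₂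
  obtain ⟨-, -, h₃⟩ := h₂
  exact ⟨h₁, h₃.symm⟩

theorem report_of_mem {k : ℕ} {u v : Fin n} (hv : v ∈ e.alive (3 * k + 2))
    (hu : u ∈ e.alive (3 * k + 1)) (hel : (e.active (3 * k) u).elected = true) :
    (e.mem (3 * k + 2) u).inbox ((e.port u).symm v) =
      some (encode (e.ident v, (e.mem (3 * k) v).pos)) := by
  rw [mem_succ_inbox, e.received_of_mem hv, send_active, if_neg (by omega), if_pos (by omega),
    e.inbox_of_elected hu hel, mem_pos_one]
  rfl

theorem answer_of_received {k : ℕ} {v i : Fin n} {m : List Bool}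
    (h : e.received (3 * k + 2) v i = some m) :
    e.port v i ∈ e.alive (3 * k + 2) ∧ (e.active (3 * k) (e.port v i)).elected = true ∧
      m = [direction (e.mem (3 * k + 2) (e.port v i)).inbox
        (encode (e.ident v, (e.mem (3 * k) v).pos))] := by
  obtain ⟨h₁, h₂⟩ := e.of_received h
  rw [send_active, if_neg (by omega), if_neg (by omega), active_elected_two] at h₂
  by_cases hel : (e.active (3 * k) (e.port v i)).elected = true
  · rw [if_pos hel, Option.map_eq_some_iff] at h₂
    obtain ⟨m', h₃, h₄⟩ := h₂
    have h₅ := (e.report_of_inbox h₃).2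
    rw [Equiv.apply_symm_apply] at h₅
    exact ⟨h₁, hel, by rw [← h₄, h₅]⟩
  · rw [if_neg hel] at h₂
    cases h₂

/-- All messages of a member that survives the phase go out, so an unanswered surviving node
certifies that every member crashed. -/
theorem received_of_elected {k : ℕ} {u v : Fin n} (hv : v ∈ e.alive (3 * k + 2))
    (hu : u ∈ e.alive (3 * k + 3)) (hel : (e.active (3 * k) u).elected = true) :
    ∃ m, e.received (3 * k + 2) v ((e.port v).symm u) = some m := by
  rw [e.received_of_mem hu, send_active, if_neg (by omega), if_neg (by omega), active_elected_two,
    if_pos hel, e.report_of_mem hv (e.alive_antitone (by omega) hu) hel]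
  exact ⟨_, rfl⟩

/-- The answers of a committee member are based on the nodes that it received reports from. -/
theorem direction_eq {k : ℕ} {u : Fin n} (hu : u ∈ e.alive (3 * k + 2))
    (hel : (e.active (3 * k) u).elected = true) :
    ∃ V, e.alive (3 * k + 2) ⊆ V ∧ V ⊆ e.alive (3 * k) ∧ ∀ v,
      direction (e.mem (3 * k + 2) u).inbox (encode (e.ident v, (e.mem (3 * k) v).pos)) =
        decide (capacity n (2 * (e.mem (3 * k) v).pos) <
          load V (fun w => (e.mem (3 * k) w).pos) (2 * (e.mem (3 * k) v).pos) +
          rank V (fun w => (e.mem (3 * k) w).pos) e.ident (e.mem (3 * k) v).pos (e.ident v)) := by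
  -- The member counts over links; `e.port u` turns this into a count over the nodes whose reports
  -- arrived, which form the set `V`.
  have key : ∀ p : ℕ × ℕ → Prop,
      #{i | ∃ r, (e.mem (3 * k + 2) u).inbox i = some r ∧ p (decode r)} =
      #{w ∈ {w : Fin n | ((e.mem (3 * k + 2) u).inbox ((e.port u).symm w)).isSome} |
        p (e.ident w, (e.mem (3 * k) w).pos)} := by
    intro p
    refine card_equiv (e.port u) fun i => ?_
    simp only [mem_filter, mem_univ, true_and, Equiv.symm_apply_apply]
    constructor
    · rintro ⟨r, hr, hp⟩
      rw [(e.report_of_inbox hr).2, decode_encode] at hp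
      exact ⟨by rw [hr]; rfl, hp⟩
    · rintro ⟨hs, hp⟩
      obtain ⟨r, hr⟩ := Option.isSome_iff_exists.1 hs
      refine ⟨r, hr, ?_⟩
      rwa [(e.report_of_inbox hr).2, decode_encode]
  refine ⟨({w : Fin n | ((e.mem (3 * k + 2) u).inbox ((e.port u).symm w)).isSome} : Finset _),
    ?_, ?_, fun v => ?_⟩
  · intro v hv
    rw [mem_filter, e.report_of_mem hv (e.alive_succ_subset _ hu) hel]
    exact ⟨mem_univ _, rfl⟩
  · intro v hv
    rw [mem_filter] at hv
    obtain ⟨r, hr⟩ := Option.isSome_iff_exists.1 hv.2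
    have := (e.report_of_inbox hr).1
    rw [Equiv.apply_symm_apply] at this
    exact e.alive_succ_subset _ this
  · unfold direction load rank
    rw [decode_encode]
    refine decide_eq_decide.2 (iff_of_eq (congrArg₂ (· < ·) rfl (congrArg₂ (· + ·) ?_ ?_)))
    · convert key fun a => Below a.2 (2 * (e.mem (3 * k) v).pos)
    · convert key fun a => a.2 = (e.mem (3 * k) v).pos ∧ a.1 ≤ e.ident v

theorem one_le_pos (t : ℕ) (v : Fin n) : 1 ≤ (e.mem t v).pos := by
  induction t with
  | zero => rfl
  | succ t ih =>
    rw [mem_succ_pos]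
    split_ifs <;> omega

theorem mem_pos_phase (k : ℕ) (v : Fin n) : (e.mem (3 * (k + 1)) v).pos =
    if (e.mem (3 * k) v).pos < 2 ^ Nat.clog 2 n then
      if ∃ i, e.received (3 * k + 2) v i = some [true] then 2 * (e.mem (3 * k) v).pos + 1
      else if ∃ i, e.received (3 * k + 2) v i = some [false] then 2 * (e.mem (3 * k) v).pos
      else (e.mem (3 * k) v).pos
    else (e.mem (3 * k) v).pos := by
  have h : (3 * k + 2) % 3 = 2 := by omega
  rw [show 3 * (k + 1) = 3 * k + 2 + 1 by ring, mem_succ_pos, mem_pos_two]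
  simp only [h, true_and]

theorem mem_level_phase (k : ℕ) (v : Fin n) : (e.mem (3 * (k + 1)) v).level =
    if ∀ i, e.received (3 * k + 2) v i = none then (e.mem (3 * k) v).level + 1
    else (e.mem (3 * k) v).level := by
  have h : (3 * k + 2) % 3 = 2 := by omega
  rw [show 3 * (k + 1) = 3 * k + 2 + 1 by ring, mem_succ_level, mem_level_two]
  simp only [h, true_and]

/-- At the beginning of a phase, no subtree is overloaded. -/
theorem load_le_capacity (hid : Function.Injective e.ident) (k : ℕ) {h : ℕ} (hh : 1 ≤ h) :
    load (e.alive (3 * k)) (fun v => (e.mem (3 * k) v).pos) h ≤ capacity n h := by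
  induction k generalizing h with
  | zero =>
    simp only [mul_zero, alive_zero, mem_zero]
    unfold load
    rcases hh.eq_or_lt with rfl | hlt
    · rw [capacity_one]
      exact (card_le_univ _).trans (Fintype.card_fin n).le
    · rw [filter_false_of_mem, card_empty]
      · exact Nat.zero_le _
      · intro v _ hb
        exact absurd hb.le (not_le.2 hlt)
  | succ k ih =>
    refine load_move hid (e.alive_antitone (by omega : 3 * k ≤ 3 * (k + 1)))
      (e.one_le_pos (3 * k)) (fun h hh => ih hh) (fun v hv => ?_) hh
    -- The member that sent the answer may crash while doing so; its answer is still based on an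
    -- admissible set `V`.
    have hex : ∀ b, (∃ i, e.received (3 * k + 2) v i = some [b]) →
        ∃ V, e.alive (3 * (k + 1)) ⊆ V ∧ V ⊆ e.alive (3 * k) ∧
          b = decide (capacity n (2 * (e.mem (3 * k) v).pos) <
          load V (fun w => (e.mem (3 * k) w).pos) (2 * (e.mem (3 * k) v).pos) +
          rank V (fun w => (e.mem (3 * k) w).pos) e.ident (e.mem (3 * k) v).pos (e.ident v)) := by
      rintro b ⟨i, hi⟩
      obtain ⟨h₁, h₂, h₃⟩ := e.answer_of_received hi
      obtain ⟨V, hV₁, hV₂, hV₃⟩ := e.direction_eq h₁ h₂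
      refine ⟨V, (e.alive_antitone (by omega)).trans hV₁, hV₂, ?_⟩
      rw [hV₃] at h₃
      exact List.singleton_injective h₃
    rw [mem_pos_phase]
    split_ifs with h₁ h₂ h₃
    · obtain ⟨V, hV₁, hV₂, hV₃⟩ := hex _ h₂
      exact Or.inr ⟨capacity_eq_add (e.one_le_pos _ _) h₁, V, hV₁, hV₂,
        Or.inr ⟨rfl, of_decide_eq_true hV₃.symm⟩⟩
    · obtain ⟨V, hV₁, hV₂, hV₃⟩ := hex _ h₃
      exact Or.inr ⟨capacity_eq_add (e.one_le_pos _ _) h₁, V, hV₁, hV₂,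
        Or.inl ⟨rfl, not_lt.1 (of_decide_eq_false hV₃.symm)⟩⟩
    · exact Or.inl rfl
    · exact Or.inl rfl

/-! ### Failing phases, and progress towards the leaves. -/

/-- Some node gets no answer in phase `k`. -/
def Fails (k : ℕ) : Prop :=
  ∃ v ∈ e.alive (3 * (k + 1)), ∀ i, e.received (3 * k + 2) v i = none

/-- If some node gets no answer, then the whole committee crashes. -/
theorem not_mem_alive_of_fails {k : ℕ} (hk : e.Fails k) {u : Fin n} (hu : u ∈ e.committee k) :
    u ∉ e.alive (3 * (k + 1)) := by
  intro hu'
  obtain ⟨v, hv, hv'⟩ := hk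
  rw [committee, mem_filter] at hu
  obtain ⟨m, hm⟩ := e.received_of_elected (e.alive_antitone (by omega) hv) hu' hu.2
  rw [hv'] at hm
  cases hm

/-- The committee and the survivors are disjoint: a failing phase costs the adversary as many
crashes as the committee has members. -/
theorem card_committee_of_fails {k : ℕ} (hk : e.Fails k) :
    #(e.committee k) + #(e.alive (3 * (k + 1))) ≤ #(e.alive (3 * k)) := by
  rw [← card_union_of_disjoint]
  · refine card_le_card (union_subset (filter_subset _ _) (e.alive_antitone (by omega)))
  · rw [disjoint_left]
    exact fun u hu => e.not_mem_alive_of_fails hk hu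

/-- At level `Nat.clog 2 n` no coin has to show `true`, so the node is surely elected. If it
survives, it receives its own answer and its level stays. -/
theorem level_le {k : ℕ} {v : Fin n} (hv : v ∈ e.alive (3 * k)) :
    (e.mem (3 * k) v).level ≤ Nat.clog 2 n := by
  induction k with
  | zero => exact Nat.zero_le _
  | succ k ih =>
    have hv' := e.alive_antitone (by omega : 3 * k ≤ 3 * (k + 1)) hv
    rw [mem_level_phase]
    split_ifs with h
    · refine Nat.succ_le_of_lt ((ih hv').lt_of_ne fun heq => ?_)
      refine e.not_mem_alive_of_fails ⟨v, hv, h⟩ (u := v) ?_ hv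
      rw [committee, mem_filter, active_elected_of_mod_eq_zero _ (by omega), decide_eq_true_eq]
      exact ⟨hv', fun i hi => absurd hi (by omega)⟩
    · exact ih hv'

/-- Until a leaf is reached, a phase doubles one of the factors: an answer at least doubles the
position, and its absence raises the level. -/
theorem progress {k : ℕ} {v : Fin n} (hv : v ∈ e.alive (3 * k)) :
    2 ^ k ≤ (e.mem (3 * k) v).pos * 2 ^ (e.mem (3 * k) v).level ∨
      2 ^ Nat.clog 2 n ≤ (e.mem (3 * k) v).pos := by
  induction k with
  | zero => exact Or.inl le_rfl
  | succ k ih =>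
    have hv' := e.alive_antitone (by omega : 3 * k ≤ 3 * (k + 1)) hv
    rw [mem_pos_phase, mem_level_phase]
    rcases lt_or_ge (e.mem (3 * k) v).pos (2 ^ Nat.clog 2 n) with hlt | hge
    · rw [if_pos hlt]
      have h := (ih hv').resolve_right (not_le.2 hlt)
      left
      by_cases hn : ∀ i, e.received (3 * k + 2) v i = none
      · have h₀ : ∀ b, ¬ ∃ i, e.received (3 * k + 2) v i = some [b] := by
          rintro b ⟨i, hi⟩
          rw [hn] at hi
          cases hi
        rw [if_neg (h₀ _), if_neg (h₀ _), if_pos hn, pow_succ, pow_succ]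
        nlinarith
      · rw [if_neg hn, pow_succ]
        push Not at hn
        obtain ⟨i, hi⟩ := hn
        obtain ⟨m, hm⟩ := Option.ne_none_iff_exists'.1 hi
        obtain ⟨-, -, h₃⟩ := e.answer_of_received hm
        split_ifs with h₁ h₂
        · nlinarith [Nat.zero_le (2 ^ (e.mem (3 * k) v).level)]
        · nlinarith
        · cases hb : direction (e.mem (3 * k + 2) (e.port v i)).inbox
            (encode (e.ident v, (e.mem (3 * k) v).pos)) with
          | false => exact absurd ⟨i, by rw [hm, h₃, hb]⟩ h₂
          | true => exact absurd ⟨i, by rw [hm, h₃, hb]⟩ h₁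
    · right
      rwa [if_neg (not_lt.2 hge)]

theorem leaf_of_mem {v : Fin n} (hv : v ∈ e.alive (6 * Nat.clog 2 n)) :
    2 ^ Nat.clog 2 n ≤ (e.mem (6 * Nat.clog 2 n) v).pos := by
  have h6 : 6 * Nat.clog 2 n = 3 * (2 * Nat.clog 2 n) := by ring
  rw [h6] at hv ⊢
  rcases e.progress hv with h | h
  · have h₁ := e.level_le hv
    have h₂ := Nat.pow_le_pow_right two_pos h₁
    rw [two_mul (Nat.clog 2 n), pow_add, ← two_mul] at h
    exact Nat.le_of_mul_le_mul_right (h.trans (Nat.mul_le_mul_left _ h₂)) (by positivity)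
  · exact h

theorem pos_lt (t : ℕ) (v : Fin n) : (e.mem t v).pos < 2 ^ (Nat.clog 2 n + 1) := by
  induction t with
  | zero => exact Nat.one_lt_two_pow (by omega)
  | succ t ih =>
    rw [mem_succ_pos, pow_succ]
    rw [pow_succ] at ih
    split_ifs <;> omega

/-- The new identities are distinct elements of `{1, …, n}`. -/
theorem strongRenaming (hid : Function.Injective e.ident) :
    (∀ v ∈ e.alive (6 * Nat.clog 2 n),
      (e.mem (6 * Nat.clog 2 n) v).pos - 2 ^ Nat.clog 2 n + 1 ∈ Set.Icc 1 n) ∧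
    ∀ u ∈ e.alive (6 * Nat.clog 2 n), ∀ v ∈ e.alive (6 * Nat.clog 2 n),
      (e.mem (6 * Nat.clog 2 n) u).pos - 2 ^ Nat.clog 2 n + 1 =
      (e.mem (6 * Nat.clog 2 n) v).pos - 2 ^ Nat.clog 2 n + 1 → u = v := by
  have h6 : 6 * Nat.clog 2 n = 3 * (2 * Nat.clog 2 n) := by ring
  have hload := fun v => e.load_le_capacity hid (2 * Nat.clog 2 n)
    (e.one_le_pos (3 * (2 * Nat.clog 2 n)) v)
  rw [← h6] at hload
  constructor
  · intro v hv
    have hc : 1 ≤ load (e.alive (6 * Nat.clog 2 n))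
        (fun v => (e.mem (6 * Nat.clog 2 n) v).pos) (e.mem (6 * Nat.clog 2 n) v).pos :=
      card_pos.2 ⟨v, mem_filter.2 ⟨hv, Below.refl _⟩⟩
    -- The node itself is a load of 1 on its leaf, so that leaf has positive capacity and is one of
    -- the first `n`.
    have := lt_of_capacity_pos (e.leaf_of_mem hv) (hc.trans (hload v))
    exact ⟨by omega, by omega⟩
  · intro u hu v hv huv
    have h₁ := e.leaf_of_mem hu
    have h₂ := e.leaf_of_mem hv
    have h₃ : (e.mem (6 * Nat.clog 2 n) u).pos = (e.mem (6 * Nat.clog 2 n) v).pos := by omega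
    refine card_le_one.1 ((hload v).trans (capacity_leaf_le h₂)) u ?_ v ?_
    · exact mem_filter.2 ⟨hu, h₃ ▸ Below.refl _⟩
    · exact mem_filter.2 ⟨hv, Below.refl _⟩

/-! ### The number of messages -/

/-- The number of messages in the round after `t` rounds. -/
noncomputable def messages (t : ℕ) : ℕ :=
  #{x : Fin n × Fin n | x.1 ∈ e.alive t ∧ ((protocol n).send (e.active t x.1) x.2).isSome}

theorem messages_le_sq (t : ℕ) : e.messages t ≤ n ^ 2 := by
  refine (card_le_univ _).trans (le_of_eq ?_)
  simp [sq]

theorem messages_le_of_elected {t k : ℕ} (ht : 3 * k ≤ t)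
    (h : ∀ v i, v ∈ e.alive t → ((protocol n).send (e.active t v) i).isSome →
      (e.active (3 * k) v).elected = true) : e.messages t ≤ n * #(e.committee k) := by
  have hsub : ({x : Fin n × Fin n | x.1 ∈ e.alive t ∧
      ((protocol n).send (e.active t x.1) x.2).isSome} : Finset _) ⊆ e.committee k ×ˢ univ := by
    rintro ⟨v, i⟩ hx
    simp only [mem_filter, mem_univ, true_and] at hx
    simp only [mem_product, mem_univ, and_true, committee, mem_filter]
    exact ⟨e.alive_antitone ht hx.1, h v i hx.1 hx.2⟩
  refine (card_le_card hsub).trans (le_of_eq ?_)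
  rw [card_product, card_univ, Fintype.card_fin, mul_comm]

theorem messages_zero_le (k : ℕ) : e.messages (3 * k) ≤ n * #(e.committee k) := by
  refine e.messages_le_of_elected le_rfl fun v i _ h => ?_
  rw [send_active, if_pos (by omega)] at h
  by_contra hne
  simp [hne] at h

/-- Reports only go back along links that brought an announcement, so they are counted by pairs of a
sender and a committee member. -/
theorem messages_one_le (k : ℕ) : e.messages (3 * k + 1) ≤ n * #(e.committee k) := by
  have : n * #(e.committee k) = #((univ : Finset (Fin n)) ×ˢ e.committee k) := by
    rw [card_product, card_univ, Fintype.card_fin]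
  rw [this]
  refine card_le_card_of_injOn (fun x => (x.1, e.port x.1 x.2)) ?_ ?_
  · rintro ⟨v, i⟩ hx
    simp only [coe_filter, Set.mem_ofPred_eq, mem_univ, true_and] at hx
    simp only [coe_product, Set.mem_prod, mem_coe, mem_univ, true_and]
    rw [send_active, if_neg (by omega), if_pos (by omega), Option.isSome_map] at hx
    obtain ⟨m, hm⟩ := Option.isSome_iff_exists.1 hx.2
    exact e.mem_committee_of_inbox hm
  · rintro ⟨v, i⟩ - ⟨v', i'⟩ - h
    simp only [Prod.mk.injEq] at h
    obtain ⟨rfl, h⟩ := h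
    rw [(e.port v).injective h]

theorem messages_two_le (k : ℕ) : e.messages (3 * k + 2) ≤ n * #(e.committee k) := by
  refine e.messages_le_of_elected (by omega) fun v i _ h => ?_
  rw [send_active, if_neg (by omega), if_neg (by omega), active_elected_two] at h
  by_contra hne
  simp [hne] at h

theorem sum_messages_le (K : ℕ) :
    ∑ t ∈ range (3 * K), e.messages t ≤ 3 * n * ∑ k ∈ range K, #(e.committee k) := by
  induction K with
  | zero => simp
  | succ K ih =>
    rw [show 3 * (K + 1) = 3 * K + 1 + 1 + 1 by ring, sum_range_succ, sum_range_succ,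
      sum_range_succ, sum_range_succ, mul_add]
    have h₀ := e.messages_zero_le K
    have h₁ := e.messages_one_le K
    have h₂ := e.messages_two_le K
    have : 3 * n * #(e.committee K) = 3 * (n * #(e.committee K)) := by ring
    change _ + e.messages (3 * K + 2) ≤ _
    omega

/-- Every message is a report or has at most one bit. -/
theorem length_le {t : ℕ} {v i : Fin n} {m : List Bool}
    (hm : (protocol n).send (e.active t v) i = some m) :
    m.length ≤ 1 ∨ m = encode (e.ident v, (e.mem t v).pos) := by
  rw [send_active] at hm
  split_ifs at hm
  · exact Or.inl (by simp [← Option.some.inj hm])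
  · obtain ⟨-, -, h⟩ := Option.map_eq_some_iff.1 hm
    exact Or.inr h.symm
  · left
    obtain ⟨_, _, h⟩ := Option.map_eq_some_iff.1 hm
    simp [← h]

end Scenario

/-! ### Random bits -/

/-- The probability that a node with level `j` is elected. -/
noncomputable def electionProb (n j : ℕ) : ℝ := 1 / 2 ^ (Nat.clog 2 n - j)

theorem electionProb_nonneg (n j : ℕ) : 0 ≤ electionProb n j := by
  unfold electionProb; positivity

theorem electionProb_le_one (n j : ℕ) : electionProb n j ≤ 1 := by
  unfold electionProb
  rw [div_le_one (by positivity)]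
  exact one_le_pow₀ one_le_two

theorem electionProb_succ_le (n j : ℕ) : electionProb n (j + 1) ≤ 2 * electionProb n j := by
  unfold electionProb
  rw [mul_one_div, div_le_div_iff₀ (by positivity) (by positivity), one_mul, ← pow_succ']
  exact pow_le_pow_right₀ one_le_two (by omega)

theorem card_elects (n j : ℕ) :
    (#{x : Coins (Nat.clog 2 n) | Elects n j x} : ℝ) = 2 ^ Nat.clog 2 n * electionProb n j := by
  have h : (univ.filter fun x : Coins (Nat.clog 2 n) => Elects n j x) =
      Fintype.piFinset fun i : Fin (Nat.clog 2 n) =>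
        if i.val < Nat.clog 2 n - j then {true} else univ := by
    ext x
    rw [mem_filter, Fintype.mem_piFinset]
    simp only [mem_univ, true_and, Elects]
    refine forall_congr' fun i => ?_
    split_ifs with hi <;> simp [hi]
  have h' : ∀ i : Fin (Nat.clog 2 n),
      #(if i.val < Nat.clog 2 n - j then {true} else univ : Finset Bool) =
        if i.val < Nat.clog 2 n - j then 1 else 2 := by
    intro i
    split_ifs <;> rfl
  rw [h, Fintype.card_piFinset, prod_congr rfl fun i _ => h' i,
    Fin.prod_univ_eq_prod_range (fun i => if i < Nat.clog 2 n - j then 1 else 2), prod_ite,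
    prod_const_one, one_mul, prod_const]
  -- The unconstrained coins; truncated subtraction also covers `j` beyond `Nat.clog 2 n`, where all
  -- coins are free.
  have hc : #{i ∈ range (Nat.clog 2 n) | ¬ i < Nat.clog 2 n - j} + (Nat.clog 2 n - j) =
      Nat.clog 2 n := by
    have h₁ : ({i ∈ range (Nat.clog 2 n) | ¬ i < Nat.clog 2 n - j} : Finset ℕ) =
        Ico (Nat.clog 2 n - j) (Nat.clog 2 n) := by
      ext i
      simp only [mem_filter, mem_range, mem_Ico]
      omega
    rw [h₁, Nat.card_Ico]
    omega
  unfold electionProb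
  rw [mul_one_div, eq_div_iff (by positivity)]
  push_cast
  rw [← pow_add, hc]

/-- The moment generating function of the election of a node. -/
theorem sum_exp_elects (j : ℕ) (a b : ℝ) :
    ∑ x : Coins (Nat.clog 2 n), Real.exp (a * (if Elects n j x then 1 else 0) + b) =
      2 ^ Nat.clog 2 n * ((1 + electionProb n j * (Real.exp a - 1)) * Real.exp b) := by
  have h : ∀ x : Coins (Nat.clog 2 n), Real.exp (a * (if Elects n j x then 1 else 0) + b) =
      (1 + (if Elects n j x then 1 else 0) * (Real.exp a - 1)) * Real.exp b := by
    intro x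
    rw [Real.exp_add]
    split_ifs <;> simp
  rw [sum_congr rfl fun x _ => h x, ← sum_mul, sum_add_distrib, ← sum_mul, sum_boole, card_elects]
  simp only [sum_const, card_univ, Fintype.card_fun, Fintype.card_bool, Fintype.card_fin]
  simp only [nsmul_eq_mul, mul_one]
  push_cast
  ring

/-! ### The potential of a round and its mean. -/

/-- The election probability of a node in the present configuration. -/
noncomputable def mass (c : (protocol n).Config) (v : Fin n) : ℝ :=
  match c v with
  | .running s => if s.time % 3 = 0 then electionProb n s.level else 0
  | _ => 0

/-- The indicator of the election of a node. -/
noncomputable def vote (c : (protocol n).Config) (v : Fin n) : ℝ :=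
  match c v with
  | .running s => if s.time % 3 = 0 ∧ s.elected then 1 else 0
  | _ => 0

/-- The potential of a round, whose mean is bounded, and whose logarithm bounds the
deviation of the size of the committee from its mean, both ways. -/
noncomputable def potential (c : (protocol n).Config) : ℝ :=
  1 + Real.exp (∑ v, (mass c v / 2 - Real.log 2 * vote c v)) +
    Real.exp (∑ v, (Real.log 2 * vote c v - mass c v))

/-- Independence of the nodes' coins: the sum of a product of one-node factors is the product of the
one-node sums. -/
theorem sum_exp_sum_le (φ : Fin n → Coins (Nat.clog 2 n) → ℝ)
    (h : ∀ v, ∑ y, Real.exp (φ v y) ≤ 2 ^ Nat.clog 2 n) :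
    ∑ x : Fin n → Coins (Nat.clog 2 n), Real.exp (∑ v, φ v (x v)) ≤ (2 ^ Nat.clog 2 n) ^ n := by
  simp only [Real.exp_sum]
  rw [← Fintype.piFinset_univ, ← prod_univ_sum (fun _ => univ) fun v y => Real.exp (φ v y)]
  refine (prod_le_prod (fun v _ => sum_nonneg fun y _ => (Real.exp_pos _).le)
    fun v _ => h v).trans (le_of_eq ?_)
  simp

theorem mass_flipAll (c : (protocol n).Config) (x : Fin n → Coins (Nat.clog 2 n)) (v : Fin n) :
    mass ((protocol n).flipAll x c) v = mass c v := by
  unfold mass Protocol.flipAll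
  rcases c v with s | k | _
  · by_cases h : s.time % 3 = 0 <;> simp [protocol, h]
  · rfl
  · rfl

theorem vote_flipAll (c : (protocol n).Config) (x : Fin n → Coins (Nat.clog 2 n)) (v : Fin n) :
    vote ((protocol n).flipAll x c) v =
      match c v with
      | .running s => if s.time % 3 = 0 then if Elects n s.level (x v) then 1 else 0 else 0
      | _ => 0 := by
  unfold vote Protocol.flipAll
  rcases c v with s | k | _
  · by_cases h : s.time % 3 = 0 <;> simp [protocol, h]
  · rfl
  · rfl

theorem sum_exp_node_le (c : (protocol n).Config) (v : Fin n) (a b : ℝ)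
    (h : ∀ j, (1 + electionProb n j * (Real.exp a - 1)) * Real.exp (b * electionProb n j) ≤ 1) :
    ∑ y : Coins (Nat.clog 2 n), Real.exp (a * (match c v with
      | .running s => if s.time % 3 = 0 then if Elects n s.level y then 1 else 0 else 0
      | _ => 0) + b * mass c v) ≤ 2 ^ Nat.clog 2 n := by
  unfold mass
  rcases c v with s | k | _
  · by_cases ht : s.time % 3 = 0
    · simp only [ht, if_true]
      rw [sum_exp_elects]
      exact mul_le_of_le_one_right (by positivity) (h _)
    · simp [ht]
  · simp
  · simp

/-- With election probability `p`, the one-node factors have means `(1 - p / 2) * exp (p / 2)` and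
`(1 + p) * exp (-p)`, both at most 1. With the constant 1, the three terms have total mean at most
3. -/
theorem sum_potential_le (c : (protocol n).Config) :
    ∑ x : Fin n → Coins (Nat.clog 2 n), potential ((protocol n).flipAll x c) ≤
      3 * (2 ^ Nat.clog 2 n) ^ n := by
  have h2 : Real.exp (Real.log 2) = 2 := Real.exp_log two_pos
  have h2' : Real.exp (-Real.log 2) = 1 / 2 := by rw [Real.exp_neg, h2]; norm_num
  have key : ∀ y : ℝ, 0 ≤ 1 + y → (1 + y) * Real.exp (-y) ≤ 1 := fun y hy => by
    rw [Real.exp_neg, ← div_eq_mul_inv, div_le_one (Real.exp_pos _), add_comm]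
    exact Real.add_one_le_exp y
  have h₁ := sum_exp_sum_le _ fun v => sum_exp_node_le c v (-Real.log 2) (1 / 2) fun j => by
    have := electionProb_le_one n j
    rw [h2']
    convert key (-(electionProb n j / 2)) (by linarith) using 2 <;> ring_nf
  have h₂ := sum_exp_sum_le _ fun v => sum_exp_node_le c v (Real.log 2) (-1) fun j => by
    have := electionProb_nonneg n j
    rw [h2]
    convert key (electionProb n j) (by linarith) using 2 <;> ring_nf
  unfold potential
  simp only [mass_flipAll, vote_flipAll]
  rw [sum_add_distrib, sum_add_distrib]
  have h₀ : ∑ _x : Fin n → Coins (Nat.clog 2 n), (1 : ℝ) = (2 ^ Nat.clog 2 n) ^ n := by simp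
  rw [h₀]
  have e₁ : ∀ x y : ℝ, x / 2 - Real.log 2 * y = -Real.log 2 * y + 1 / 2 * x := fun x y => by ring
  have e₂ : ∀ x y : ℝ, Real.log 2 * y - x = Real.log 2 * y + -1 * x := fun x y => by ring
  simp only [e₁, e₂]
  linarith

/-- This is the purpose of the summand 1: logarithms are nonnegative, so rounds may be added to a
sum of them. -/
theorem one_le_potential (c : (protocol n).Config) : 1 ≤ potential c := by
  unfold potential
  have := Real.exp_pos (∑ v, (mass c v / 2 - Real.log 2 * vote c v))
  have := Real.exp_pos (∑ v, (Real.log 2 * vote c v - mass c v))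
  linarith

theorem le_log_potential (c : (protocol n).Config) :
    (∑ v, mass c v) / 2 - Real.log 2 * ∑ v, vote c v ≤ Real.log (potential c) := by
  rw [Real.le_log_iff_exp_le (one_pos.trans_le (one_le_potential c)), sum_div, mul_sum,
    ← sum_sub_distrib]
  unfold potential
  have := Real.exp_pos (∑ v, (Real.log 2 * vote c v - mass c v))
  linarith

theorem le_log_potential' (c : (protocol n).Config) :
    Real.log 2 * ∑ v, vote c v - ∑ v, mass c v ≤ Real.log (potential c) := by
  rw [Real.le_log_iff_exp_le (one_pos.trans_le (one_le_potential c)), mul_sum,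
    ← sum_sub_distrib]
  unfold potential
  have := Real.exp_pos (∑ v, (mass c v / 2 - Real.log 2 * vote c v))
  linarith

/-- The product of the potentials of all rounds. -/
noncomputable def totalPotential (E : (protocol n).Execution) : ℝ :=
  (E.history.map fun r => potential r.config).prod

theorem totalPotential_pos (E : (protocol n).Execution) : 0 < totalPotential E := by
  refine List.prod_pos fun x hx => ?_
  obtain ⟨r, -, rfl⟩ := List.mem_map.1 hx
  exact one_pos.trans_le (one_le_potential _)

theorem Protocol.run_snoc (P : Protocol n) (ident : Fin n → ℕ)
    (port : Fin n → Equiv.Perm (Fin n)) (adv : P.Adversary) (T : ℕ)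
    (ω : Fin T → Fin n → Coins P.coinBits) (x : Fin n → Coins P.coinBits) :
    P.run ident port adv (T + 1) (Fin.snoc (α := fun _ => Fin n → Coins P.coinBits) ω x) =
      P.step port adv x (P.run ident port adv T ω) := by
  rw [Protocol.run, Fin.snoc_last, Fin.init_snoc]

/-- Condition on the first `T` rounds. The next potential depends only on the configuration they
leave and on fresh coins, as the adversary's decision of that round comes later; so it contributes a
factor of mean at most 3. -/
theorem sum_totalPotential_le (ident : Fin n → ℕ) (port : Fin n → Equiv.Perm (Fin n))
    (adv : (protocol n).Adversary) (T : ℕ) :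
    ∑ ω : Fin T → Fin n → Coins (Nat.clog 2 n),
      totalPotential ((protocol n).run ident port adv T ω) ≤ (3 * (2 ^ Nat.clog 2 n) ^ n) ^ T := by
  induction T with
  | zero => simp [totalPotential, Protocol.run]
  | succ T ih =>
    rw [← (Fin.snocEquiv fun _ : Fin (T + 1) => Fin n → Coins (Nat.clog 2 n)).sum_comp,
      Fintype.sum_prod_type_right, pow_succ]
    refine le_trans (sum_le_sum fun ω _ => ?_)
      ((sum_mul univ _ _).symm.le.trans (mul_le_mul_of_nonneg_right ih (by positivity)))
    have hrun : ∀ x : Fin n → Coins (Nat.clog 2 n),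
        totalPotential ((protocol n).run ident port adv (T + 1)
          (Fin.snocEquiv (fun _ : Fin (T + 1) => Fin n → Coins (Nat.clog 2 n)) (x, ω))) =
        totalPotential ((protocol n).run ident port adv T ω) *
          potential ((protocol n).flipAll x ((protocol n).run ident port adv T ω).config) := by
      intro x
      refine (congrArg totalPotential ((protocol n).run_snoc ident port adv T ω x)).trans ?_
      simp [totalPotential, Protocol.step]
    rw [sum_congr rfl fun x _ => hrun x, ← mul_sum]
    exact mul_le_mul_of_nonneg_left (sum_potential_le _) (totalPotential_pos _).le

/-- Markov's inequality for the uniform distribution. -/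
theorem uniformOn_markov {Ω : Type*} [Fintype Ω] [Nonempty Ω] [MeasurableSpace Ω]
    [MeasurableSingletonClass Ω] {f : Ω → ℝ} {a b : ℝ} (ha : 0 < a) (hb : 0 < b)
    (hf : ∀ ω, 0 ≤ f ω) (hsum : ∑ ω, f ω ≤ a * Fintype.card Ω) {G : Set Ω}
    (hG : ∀ ω, f ω ≤ b * a → ω ∈ G) :
    1 - 1 / b ≤ (ProbabilityTheory.uniformOn (Set.univ : Set Ω)).real G := by
  have hpos : (0 : ℝ) < Fintype.card Ω := by exact_mod_cast Fintype.card_pos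
  have hbad : (#{ω | ω ∉ G} : ℝ) * b ≤ Fintype.card Ω := by
    have h₁ : (#{ω | ω ∉ G} : ℝ) * (b * a) ≤ ∑ ω, f ω := by
      rw [← nsmul_eq_mul]
      refine (card_nsmul_le_sum _ _ _ fun ω hω => ?_).trans (sum_le_univ_sum_of_nonneg hf)
      rw [mem_filter] at hω
      exact (not_le.1 fun h => hω.2 (hG ω h)).le
    have h₂ := h₁.trans hsum
    rw [← mul_assoc, mul_comm a] at h₂
    exact le_of_mul_le_mul_right h₂ ha
  have hsplit : (#{ω | ω ∈ G} : ℝ) + #{ω | ω ∉ G} = Fintype.card Ω := by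
    exact_mod_cast card_filter_add_card_filter_not (s := univ) (fun ω => ω ∈ G)
  have hreal : (ProbabilityTheory.uniformOn (Set.univ : Set Ω)).real G =
      #{ω | ω ∈ G} / (Fintype.card Ω : ℝ) := by
    rw [MeasureTheory.measureReal_def, ProbabilityTheory.uniformOn_univ, ENNReal.toReal_div,
      MeasureTheory.Measure.count_apply_finite _ (Set.toFinite G)]
    simp only [ENNReal.toReal_natCast]
    congr 3
    ext ω
    simp
  rw [hreal, le_div_iff₀ hpos, sub_mul, one_mul, one_div, inv_mul_eq_div]
  have := (le_div_iff₀ hb).2 hbad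
  linarith

/-- With high probability, the total potential is small. -/
theorem uniformOn_totalPotential_le (hn : 1 ≤ n) (ident : Fin n → ℕ)
    (port : Fin n → Equiv.Perm (Fin n)) (adv : (protocol n).Adversary) (T : ℕ)
    (G : Set (Fin T → Fin n → Coins (Nat.clog 2 n)))
    (hG : ∀ ω, totalPotential ((protocol n).run ident port adv T ω) ≤ n * 3 ^ T → ω ∈ G) :
    1 - 1 / (n : ℝ) ≤
      (ProbabilityTheory.uniformOn
        (Set.univ : Set (Fin T → Fin n → Coins (Nat.clog 2 n)))).real G := by
  refine uniformOn_markov (a := 3 ^ T) (by positivity) (by exact_mod_cast hn)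
    (fun ω => (totalPotential_pos _).le)
    ((sum_totalPotential_le ident port adv T).trans (le_of_eq ?_)) hG
  simp [mul_pow]

namespace Scenario

variable (e : Scenario n)

/-! ### The size of the committees -/

/-- The configuration before sending in the round after `t` rounds. -/
noncomputable def sending (t : ℕ) : (protocol n).Config :=
  (protocol n).flipAll (e.coins t) (e.config t)

theorem messagesFrom_sending {t : ℕ} (ht : t < 6 * Nat.clog 2 n) :
    (protocol n).messagesFrom (e.sending t) = e.messages t := by
  unfold Protocol.messagesFrom messages
  congr 1
  ext ⟨v, i⟩
  simp only [mem_filter, mem_univ, true_and, sending, e.flipAll_config ht, Protocol.outgoing]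
  by_cases hv : v ∈ e.alive t <;> simp [hv]

/-- The expected size of the committee of phase `k`. -/
noncomputable def expected (k : ℕ) : ℝ :=
  ∑ v ∈ e.alive (3 * k), electionProb n (e.mem (3 * k) v).level

theorem sum_mass {k : ℕ} (hk : 3 * k < 6 * Nat.clog 2 n) :
    ∑ v, mass (e.sending (3 * k)) v = e.expected k := by
  have h : ∀ v, mass (e.sending (3 * k)) v =
      if v ∈ e.alive (3 * k) then electionProb n (e.mem (3 * k) v).level else 0 := by
    intro v
    rw [sending, e.flipAll_config hk, mass]
    by_cases hv : v ∈ e.alive (3 * k) <;> simp [hv, active_time, mem_time, active_level]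
  rw [sum_congr rfl fun v _ => h v, sum_ite_mem, univ_inter, expected]

theorem sum_vote {k : ℕ} (hk : 3 * k < 6 * Nat.clog 2 n) :
    ∑ v, vote (e.sending (3 * k)) v = #(e.committee k) := by
  have h : ∀ v, vote (e.sending (3 * k)) v = if v ∈ e.committee k then 1 else 0 := by
    intro v
    have hc : v ∈ e.committee k ↔ v ∈ e.alive (3 * k) ∧ (e.active (3 * k) v).elected = true :=
      mem_filter
    rw [sending, e.flipAll_config hk, vote]
    simp only [hc]
    by_cases hv : v ∈ e.alive (3 * k) <;> simp [hv, active_time, mem_time]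
  rw [sum_congr rfl fun v _ => h v, sum_boole, filter_univ_mem]

theorem expected_zero_le : e.expected 0 ≤ 1 := by
  have h : (n : ℝ) ≤ 2 ^ Nat.clog 2 n := by exact_mod_cast Nat.le_pow_clog one_lt_two n
  simp only [expected, mul_zero, alive_zero, mem_zero, electionProb, sum_const, card_univ,
    Fintype.card_fin, Nat.sub_zero, nsmul_eq_mul]
  rw [mul_one_div]
  exact div_le_one_of_le₀ h (by positivity)

/-- Only an unanswered node changes its level, by one, and crashes only remove terms. -/
theorem expected_succ_le (k : ℕ) :
    e.expected (k + 1) ≤ e.expected k + if e.Fails k then e.expected k else 0 := by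
  have hsub : ∀ f : Fin n → ℝ, (∀ v, 0 ≤ f v) →
      ∑ v ∈ e.alive (3 * (k + 1)), f v ≤ ∑ v ∈ e.alive (3 * k), f v := fun f hf =>
    sum_le_sum_of_subset_of_nonneg (e.alive_antitone (by omega)) fun v _ _ => hf v
  split_ifs with hk
  · rw [← two_mul]
    unfold expected
    rw [mul_sum]
    refine le_trans (sum_le_sum fun v _ => ?_)
      (hsub (fun v => 2 * electionProb n (e.mem (3 * k) v).level) fun v => ?_)
    · rw [mem_level_phase]
      split_ifs
      · exact electionProb_succ_le _ _
      · linarith [electionProb_nonneg n (e.mem (3 * k) v).level]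
    · exact mul_nonneg zero_le_two (electionProb_nonneg _ _)
  · rw [add_zero]
    refine le_trans (le_of_eq (sum_congr rfl fun v hv => ?_)) (hsub _ fun v => electionProb_nonneg _ _)
    rw [mem_level_phase, if_neg fun h => hk ⟨v, hv, h⟩]

theorem expected_le_add (k : ℕ) :
    e.expected k ≤ 1 + ∑ j ∈ range k, if e.Fails j then e.expected j else 0 := by
  induction k with
  | zero => simpa using e.expected_zero_le
  | succ k ih =>
    rw [sum_range_succ]
    linarith [e.expected_succ_le k]

/-- Telescoping `card_committee_of_fails`: each crash pays for membership in at most one failing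
committee. -/
theorem sum_committee_of_fails_le (k : ℕ) :
    (∑ j ∈ range k, if e.Fails j then (#(e.committee j) : ℝ) else 0) ≤
      n - #(e.alive (3 * k)) := by
  induction k with
  | zero => simp [alive_zero]
  | succ k ih =>
    rw [sum_range_succ]
    split_ifs with h
    · have : (#(e.committee k) : ℝ) + #(e.alive (3 * (k + 1))) ≤ #(e.alive (3 * k)) := by
        exact_mod_cast e.card_committee_of_fails h
      linarith
    · have : (#(e.alive (3 * (k + 1))) : ℝ) ≤ #(e.alive (3 * k)) := by
        exact_mod_cast card_le_card (e.alive_antitone (by omega))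
      linarith

/-- A bound on the sizes of the committees in terms of the number of crashes and the deviations
from the means. -/
theorem sum_committee_le {K : ℕ} {D : ℝ} (hK : K ≤ 2 * Nat.clog 2 n)
    (hD : ∑ k ∈ range K, Real.log (potential (e.sending (3 * k))) ≤ D) :
    ∑ k ∈ range K, (#(e.committee k) : ℝ) ≤
      2 * (K * (1 + 2 * (n - #(e.alive (3 * K))) + 2 * D) + D) := by
  have hlog : ∀ k, 0 ≤ Real.log (potential (e.sending (3 * k))) := fun k =>
    Real.log_nonneg (one_le_potential _)
  have hl2 : Real.log 2 ≤ 1 := by linarith [Real.log_two_lt_d9]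
  have hl2' : 1 / 2 ≤ Real.log 2 := by linarith [Real.log_two_gt_d9]
  have hexp : ∀ k ∈ range K, e.expected k ≤ 1 + 2 * (n - #(e.alive (3 * K))) + 2 * D := by
    intro k hk
    rw [mem_range] at hk
    -- In a failing phase the mean is charged to the crashed committee, up to the deviation.
    have h₁ : ∀ j ∈ range k, (if e.Fails j then e.expected j else 0) ≤
        2 * (if e.Fails j then (#(e.committee j) : ℝ) else 0) +
          2 * Real.log (potential (e.sending (3 * j))) := by
      intro j hj
      rw [mem_range] at hj
      have h₂ := le_log_potential (e.sending (3 * j))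
      rw [e.sum_mass (by omega), e.sum_vote (by omega)] at h₂
      have h₃ : Real.log 2 * #(e.committee j) ≤ #(e.committee j) :=
        mul_le_of_le_one_left (Nat.cast_nonneg _) hl2
      split_ifs
      · linarith
      · linarith [hlog j]
    have h₂ := sum_le_sum h₁
    rw [sum_add_distrib, ← mul_sum, ← mul_sum] at h₂
    have h₃ := e.sum_committee_of_fails_le k
    have h₄ : (#(e.alive (3 * K)) : ℝ) ≤ #(e.alive (3 * k)) := by
      exact_mod_cast card_le_card (e.alive_antitone (by omega))
    have h₅ : ∑ j ∈ range k, Real.log (potential (e.sending (3 * j))) ≤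
        ∑ j ∈ range K, Real.log (potential (e.sending (3 * j))) :=
      sum_le_sum_of_subset_of_nonneg (range_subset_range.2 hk.le) fun j _ _ => hlog j
    linarith [e.expected_le_add k]
  -- The opposite deviation bounds each committee by its mean; `1 / 2 ≤ Real.log 2` gives the outer
  -- factor 2.
  have h₁ : ∀ k ∈ range K, Real.log 2 * (#(e.committee k) : ℝ) ≤
      e.expected k + Real.log (potential (e.sending (3 * k))) := by
    intro k hk
    rw [mem_range] at hk
    have h₂ := le_log_potential' (e.sending (3 * k))
    rw [e.sum_mass (by omega), e.sum_vote (by omega)] at h₂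
    linarith
  have h₂ := sum_le_sum h₁
  rw [← mul_sum, sum_add_distrib] at h₂
  have h₃ := sum_le_card_nsmul _ _ _ hexp
  rw [card_range, nsmul_eq_mul] at h₃
  have h₄ : 1 / 2 * ∑ k ∈ range K, (#(e.committee k) : ℝ) ≤
      Real.log 2 * ∑ k ∈ range K, (#(e.committee k) : ℝ) :=
    mul_le_mul_of_nonneg_right hl2' (sum_nonneg fun _ _ => Nat.cast_nonneg _)
  linarith

end Scenario

/-! ### Executions -/

/-- Every execution is described by a scenario. -/
theorem exists_scenario (ident : Fin n → ℕ) (port : Fin n → Equiv.Perm (Fin n))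
    (adv : (protocol n).Adversary)
    (ω : Fin (6 * Nat.clog 2 n) → Fin n → Coins (Nat.clog 2 n)) :
    ∃ e : Scenario n, e.ident = ident ∧
      ((protocol n).run ident port adv (6 * Nat.clog 2 n) ω).config =
        e.config (6 * Nat.clog 2 n) ∧
      ((protocol n).run ident port adv (6 * Nat.clog 2 n) ω).history =
        (List.range (6 * Nat.clog 2 n)).map fun t => ⟨e.coins t, e.sending t, e.crash t⟩ := by
  let x : ℕ → Fin n → Coins (Nat.clog 2 n) := fun t =>
    if h : t < 6 * Nat.clog 2 n then ω ⟨t, h⟩ else fun _ _ => false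
  let E : ℕ → (protocol n).Execution := fun t =>
    (protocol n).run ident port adv t fun i => x i
  -- Once the coins are fixed, the adversary's decisions along the run form a fixed sequence of
  -- crashes.
  let e : Scenario n := ⟨ident, port, x, fun t =>
    adv (E t).history (x t) ((protocol n).flipAll (x t) (E t).config)⟩
  have hE : ∀ t, E (t + 1) = (protocol n).step port adv (x t) (E t) := fun t => rfl
  have hconf : ∀ t ≤ 6 * Nat.clog 2 n, (E t).config = e.config t := by
    intro t ht
    induction t with
    | zero => exact e.config_zero.symm
    | succ t ih =>
      rw [e.config_succ ht, hE, ← ih (by omega)]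
      rfl
  have hhist : ∀ t ≤ 6 * Nat.clog 2 n, (E t).history =
      (List.range t).map fun t => ⟨e.coins t, e.sending t, e.crash t⟩ := by
    intro t ht
    induction t with
    | zero => rfl
    | succ t ih =>
      rw [hE, List.range_succ, List.map_append, ← ih (by omega), List.map_singleton]
      unfold Scenario.sending
      rw [← hconf t (by omega)]
      rfl
  have hω : (fun i : Fin (6 * Nat.clog 2 n) => x i) = ω := by
    funext i
    simp [x]
  refine ⟨e, rfl, ?_, ?_⟩
  · rw [← hconf _ le_rfl]
    simp only [E, hω]
  · rw [← hhist _ le_rfl]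
    simp only [E, hω]

/-! ### Estimates -/

theorem clog_le_log {a : ℕ} (ha : 1 ≤ a) : (Nat.clog 2 a : ℝ) ≤ 3 * Real.log a := by
  rcases ha.eq_or_lt with rfl | ha
  · simp
  · have h₁ := Nat.pow_pred_clog_lt_self one_lt_two ha
    have h₂ : ((Nat.clog 2 a - 1 : ℕ) : ℝ) * Real.log 2 ≤ Real.log a := by
      rw [← Real.log_pow]
      exact Real.log_le_log (by positivity) (by exact_mod_cast h₁.le)
    have h₃ : 1 ≤ Nat.clog 2 a := Nat.clog_pos one_lt_two ha
    rw [Nat.cast_sub h₃, Nat.cast_one] at h₂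
    have h₄ : Real.log 2 ≤ Real.log a := Real.log_le_log two_pos (by exact_mod_cast ha)
    -- So far `Nat.clog 2 a * Real.log 2 ≤ 2 * Real.log a`; this turns the factor 2 into 3.
    have h₅ : 2 / 3 ≤ Real.log 2 := by linarith [Real.log_two_gt_d9]
    have h₆ : (2 / 3 : ℝ) * Nat.clog 2 a ≤ Real.log 2 * Nat.clog 2 a :=
      mul_le_mul_of_nonneg_right h₅ (Nat.cast_nonneg _)
    linarith

theorem one_le_two_mul_log {a : ℕ} (ha : 2 ≤ a) : 1 ≤ 2 * Real.log a := by
  have h : Real.log 2 ≤ Real.log a := Real.log_le_log two_pos (by exact_mod_cast ha)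
  linarith [Real.log_two_gt_d9]

theorem length_encode_le {N a b : ℕ} (hn : 2 ≤ n) (hN : n ≤ N) (ha : a ≤ N)
    (hb : b < 2 ^ (Nat.clog 2 n + 1)) : ((encode (a, b)).length : ℝ) ≤ 18 * Real.log N := by
  have h₁ : 2 ^ (Nat.clog 2 n + 1) < 4 * n := by
    have h := Nat.pow_pred_clog_lt_self one_lt_two hn
    have h' : Nat.clog 2 n + 1 = (Nat.clog 2 n).pred + 2 := by
      have : 0 < Nat.clog 2 n := Nat.clog_pos one_lt_two hn
      simp only [Nat.pred_eq_sub_one]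
      omega
    rw [h', pow_add]
    simp only [Nat.pred_eq_sub_one] at h ⊢
    omega
  have h₂ : (encode (a, b)).length ≤ 6 + 2 * Nat.clog 2 N := by
    rw [encode, Nat.size_eq_bits_len, Nat.size_le]
    refine (Nat.pair_lt_max_add_one_sq a b).trans_le ?_
    have h₃ : max a b + 1 ≤ 8 * 2 ^ Nat.clog 2 N := by
      have := Nat.le_pow_clog one_lt_two N
      omega
    calc (max a b + 1) ^ 2 ≤ (8 * 2 ^ Nat.clog 2 N) ^ 2 := Nat.pow_le_pow_left h₃ 2
      _ = 2 ^ (6 + 2 * Nat.clog 2 N) := by ring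
  have h₃ : ((encode (a, b)).length : ℝ) ≤ 6 + 2 * Nat.clog 2 N := by exact_mod_cast h₂
  -- `6 ≤ 12 * Real.log N` and `2 * Nat.clog 2 N ≤ 6 * Real.log N` add up to 18.
  linarith [clog_le_log (show 1 ≤ N by omega), one_le_two_mul_log (hn.trans hN)]

theorem sum_range_phase_le {f : ℕ → ℝ} (hf : ∀ t, 0 ≤ f t) (K : ℕ) :
    ∑ k ∈ range K, f (3 * k) ≤ ∑ t ∈ range (3 * K), f t := by
  induction K with
  | zero => simp
  | succ K ih =>
    rw [show 3 * (K + 1) = 3 * K + 1 + 1 + 1 by ring, sum_range_succ, sum_range_succ,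
      sum_range_succ, sum_range_succ]
    linarith [hf (3 * K + 1), hf (3 * K + 1 + 1)]

theorem messages_eq_sum {E : (protocol n).Execution} {e : Scenario n}
    (hE : E.history =
      (List.range (6 * Nat.clog 2 n)).map fun t => ⟨e.coins t, e.sending t, e.crash t⟩) :
    E.messages = ∑ t ∈ range (6 * Nat.clog 2 n), e.messages t := by
  rw [Protocol.Execution.messages, hE, List.map_map]
  exact sum_congr (s₁ := range (6 * Nat.clog 2 n)) rfl fun t ht =>
    e.messagesFrom_sending (mem_range.1 ht)

theorem log_totalPotential_eq_sum {E : (protocol n).Execution} {e : Scenario n}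
    (hE : E.history =
      (List.range (6 * Nat.clog 2 n)).map fun t => ⟨e.coins t, e.sending t, e.crash t⟩) :
    Real.log (totalPotential E) =
      ∑ t ∈ range (6 * Nat.clog 2 n), Real.log (potential (e.sending t)) := by
  rw [totalPotential, hE, List.map_map,
    ← Real.log_prod fun t _ => (one_pos.trans_le (one_le_potential (e.sending t))).ne']
  rfl

theorem crashes_eq {E : (protocol n).Execution} {e : Scenario n}
    (hE : E.config = e.config (6 * Nat.clog 2 n)) :
    (E.crashes : ℝ) = n - #(e.alive (6 * Nat.clog 2 n)) := by
  have h : {v | E.config v = .crashed} = ↑(e.alive (6 * Nat.clog 2 n))ᶜ := by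
    ext v
    simp only [hE, Scenario.config, e.settle_mem, le_refl, if_true, Set.mem_ofPred_eq, coe_compl,
      Set.mem_compl_iff, mem_coe]
    split_ifs with hv <;> simp [hv]
  have hcard : #(e.alive (6 * Nat.clog 2 n)) ≤ n := by
    simpa using card_le_univ (e.alive (6 * Nat.clog 2 n))
  rw [Protocol.Execution.crashes, h, Set.ncard_coe_finset, card_compl, Fintype.card_fin,
    Nat.cast_sub hcard]

/-- The bound on the number of messages if the total potential is small. -/
theorem messages_le_of_totalPotential_le (hn : 2 ≤ n) {E : (protocol n).Execution} {e : Scenario n}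
    (hconf : E.config = e.config (6 * Nat.clog 2 n))
    (hhist : E.history =
      (List.range (6 * Nat.clog 2 n)).map fun t => ⟨e.coins t, e.sending t, e.crash t⟩)
    (hE : totalPotential E ≤ n * 3 ^ (6 * Nat.clog 2 n)) :
    (E.messages : ℝ) ≤ 10000 * ((E.crashes + Real.log n) * (n * Real.log n)) := by
  have hn0 : (0 : ℝ) < n := by positivity
  have hL := clog_le_log (show 1 ≤ n by omega)
  have h1 := one_le_two_mul_log hn
  have h63 : 6 * Nat.clog 2 n = 3 * (2 * Nat.clog 2 n) := by ring
  -- `37 = 1 + 18 * 2`: the factor `n` gives `log n`, and there are at most `18 * log n` rounds,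
  -- each contributing `log 3 ≤ 2`.
  have hD : ∑ k ∈ range (2 * Nat.clog 2 n), Real.log (potential (e.sending (3 * k))) ≤
      37 * Real.log n := by
    refine (sum_range_phase_le (f := fun t => Real.log (potential (e.sending t)))
      (fun t => Real.log_nonneg (one_le_potential _)) _).trans ?_
    rw [← h63, ← log_totalPotential_eq_sum hhist]
    refine (Real.log_le_log (totalPotential_pos E) hE).trans ?_
    rw [Real.log_mul hn0.ne' (by positivity), Real.log_pow]
    have h3 : Real.log 3 ≤ 2 := by
      have := Real.log_le_sub_one_of_pos (show (0 : ℝ) < 3 by norm_num)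
      linarith
    have : ((6 * Nat.clog 2 n : ℕ) : ℝ) * Real.log 3 ≤ (6 * Nat.clog 2 n : ℕ) * 2 :=
      mul_le_mul_of_nonneg_left h3 (Nat.cast_nonneg _)
    push_cast at this ⊢
    linarith
  have hX := e.sum_committee_le le_rfl hD
  rw [← h63, ← crashes_eq hconf] at hX
  have hM := e.sum_messages_le (2 * Nat.clog 2 n)
  rw [← h63, ← messages_eq_sum hhist] at hM
  have hM' : (E.messages : ℝ) ≤
      3 * n * ∑ k ∈ range (2 * Nat.clog 2 n), (#(e.committee k) : ℝ) := by exact_mod_cast hM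
  refine hM'.trans ?_
  have hf : (0 : ℝ) ≤ E.crashes := Nat.cast_nonneg _
  set f : ℝ := (E.crashes : ℝ)
  set l := Real.log n
  have hl : 0 ≤ l := by linarith
  push_cast at hX
  have hX' : ∑ k ∈ range (2 * Nat.clog 2 n), (#(e.committee k) : ℝ) ≤ 3000 * ((f + l) * l) := by
    refine hX.trans ?_
    -- The constant 1 is absorbed as `1 ≤ 2 * l`, which needs `n ≥ 2`.
    have h₁ : 2 * (Nat.clog 2 n : ℝ) * (1 + 2 * f + 2 * (37 * l)) ≤
        6 * l * (2 * l + 2 * f + 2 * (37 * l)) := by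
      refine mul_le_mul (by linarith) (by linarith) (by positivity) (by positivity)
    nlinarith [mul_nonneg hf hl, mul_nonneg hl hl]
  calc 3 * n * ∑ k ∈ range (2 * Nat.clog 2 n), (#(e.committee k) : ℝ)
      ≤ 3 * n * (3000 * ((f + l) * l)) := by gcongr
    _ = 9000 * ((f + l) * (n * l)) := by ring
    _ ≤ 10000 * ((f + l) * (n * l)) := by
      refine mul_le_mul_of_nonneg_right (by norm_num) (by positivity)

end Committee

end Renaming

/-! ### The main theorem. -/

theorem theorem1 :
    ∃ (C : ℝ) (A : ∀ n : ℕ, Renaming.Protocol n),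
      ∀ n : ℕ, 1 ≤ n →
        ∃ T : ℕ, (T : ℝ) ≤ C * Real.log n ∧
          ∀ (N : ℕ) (ident : Fin n → ℕ), Function.Injective ident →
            (∀ v, ident v ∈ Set.Icc 1 N) →
            ∀ (port : Fin n → Equiv.Perm (Fin n)) (adv : (A n).Adversary),
              (∀ ω : Fin T → Fin n → Renaming.Coins (A n).coinBits,
                ((A n).run ident port adv T ω).Terminated ∧
                ((A n).run ident port adv T ω).StrongRenaming ∧
                (((A n).run ident port adv T ω).messages : ℝ) ≤
                  C * ((n : ℝ) ^ 2 * Real.log n) ∧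
                ((A n).run ident port adv T ω).MessageBitsLE (C * Real.log N)) ∧
              1 - 1 / (n : ℝ) ≤
                (ProbabilityTheory.uniformOn
                  (Set.univ : Set (Fin T → Fin n → Renaming.Coins (A n).coinBits))).real
                  {ω | (((A n).run ident port adv T ω).messages : ℝ) ≤
                    C * (((((A n).run ident port adv T ω).crashes : ℝ) + Real.log n) *
                      (n * Real.log n))} := by
  refine ⟨10000, Renaming.protocol, fun n hn => ⟨6 * Nat.clog 2 n, ?_, ?_⟩⟩
  · have := Renaming.clog_le_log hn
    have := Real.log_natCast_nonneg n
    push_cast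
    linarith
  intro N ident hid hN port adv
  constructor
  · intro ω
    obtain ⟨e, rfl, hconf, hhist⟩ := Renaming.exists_scenario ident port adv ω
    set E := (Renaming.protocol n).run e.ident port adv (6 * Nat.clog 2 n) ω
    have hstatus : ∀ v, E.config v = if v ∈ e.alive (6 * Nat.clog 2 n) then
        .returned ((e.mem (6 * Nat.clog 2 n) v).pos - 2 ^ Nat.clog 2 n + 1) else .crashed := by
      intro v
      rw [hconf, Renaming.Scenario.config, e.settle_mem, if_pos le_rfl]
    have hreturned : ∀ v k, E.config v = .returned k → v ∈ e.alive (6 * Nat.clog 2 n) ∧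
        (e.mem (6 * Nat.clog 2 n) v).pos - 2 ^ Nat.clog 2 n + 1 = k := by
      intro v k hk
      rw [hstatus] at hk
      split_ifs at hk with hv
      exact ⟨hv, by injection hk⟩
    refine ⟨?_, ⟨?_, ?_⟩, ?_, ?_⟩
    · intro v s hs
      rw [hstatus] at hs
      split_ifs at hs
    · intro v k hk
      obtain ⟨hv, rfl⟩ := hreturned v k hk
      exact (e.strongRenaming hid).1 v hv
    · intro u v k hu hv
      obtain ⟨hu', rfl⟩ := hreturned u k hu
      obtain ⟨hv', hk⟩ := hreturned v _ hv
      exact (e.strongRenaming hid).2 u hu' v hv' hk.symm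
    · have h₁ : E.messages ≤ 6 * Nat.clog 2 n * n ^ 2 := by
        rw [Renaming.messages_eq_sum hhist]
        refine (Finset.sum_le_card_nsmul _ _ _ fun t _ => e.messages_le_sq t).trans (le_of_eq ?_)
        simp
      have h₂ : (E.messages : ℝ) ≤ 6 * Nat.clog 2 n * (n : ℝ) ^ 2 := by exact_mod_cast h₁
      have h₃ := mul_le_mul_of_nonneg_right (Renaming.clog_le_log hn) (sq_nonneg (n : ℝ))
      have h₄ := mul_nonneg (sq_nonneg (n : ℝ)) (Real.log_natCast_nonneg n)
      linarith
    · intro r hr v i m hm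
      rw [hhist, List.mem_map] at hr
      obtain ⟨t, ht, rfl⟩ := hr
      rw [List.mem_range] at ht
      -- For `n = 1` there are no rounds. Otherwise `N ≥ n ≥ 2`, so even a one-bit message is within
      -- a multiple of `log N`.
      have hn2 : 2 ≤ n := by
        by_contra hlt
        rw [Nat.clog_of_right_le_one (by omega)] at ht
        omega
      have hnN : n ≤ N := by
        have := Finset.card_le_card_of_injOn (s := Finset.univ) (t := Finset.Icc 1 N) e.ident
          (fun v _ => by simpa using hN v) hid.injOn
        simpa using this
      have hlog := Renaming.one_le_two_mul_log (hn2.trans hnN)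
      rw [Renaming.Scenario.sending, e.flipAll_config ht, Renaming.Protocol.outgoing] at hm
      have hs : (Renaming.protocol n).send (e.active t v) i = some m := by
        by_cases hv : v ∈ e.alive t
        · simpa only [hv, if_true] using hm
        · simp only [hv, if_false] at hm
          cases hm
      rcases e.length_le hs with h | rfl
      · have : (m.length : ℝ) ≤ 1 := by exact_mod_cast h
        linarith
      · have := Renaming.length_encode_le hn2 hnN (hN v).2 (e.pos_lt t v)
        linarith
  -- For `n = 1` the claimed probability is at least 0, which is trivial.
  · rcases hn.eq_or_lt with rfl | hn2
    · simp
    · refine Renaming.uniformOn_totalPotential_le hn ident port adv _ _ fun ω hω => ?_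
      obtain ⟨e, -, hconf, hhist⟩ := Renaming.exists_scenario ident port adv ω
      exact Renaming.messages_le_of_totalPotential_le hn2 hconf hhist hω
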